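/- All languages are countable and all structures are nonempty. A sentence of $L_{\omega_1,\omega}$ (over a countable language $L$) is \emph{complete} if it has a model and, for every $L_{\omega_1,\omega}$-sentence $\psi$ over $L$, either $\psi$ holds in all of its models or $\neg\psi$ holds in all of its models. An infinite cardinal $\kappa$ is \emph{characterizable} if there is a complete $L_{\omega_1,\omega}$-sentence, in some countable language, that has models in all infinite cardinalities up to $\kappa$ but no model of cardinality $\kappa^+$. Theorem. Let $\lambda$ be an infinite cardinal, let $L$ be a countable language with a binary relation symbol $<$, and let $\phi$ be a complete $L_{\omega_1,\omega}$-sentence over $L$ such that 1. for every model $\mathcal M$ of $\phi$, $<^{\mathcal M}$ is a (strict) linear order of its field $\{x\in\mathcal M : \exists y\,(x<^{\mathcal M}y \text{ or } y<^{\mathcal M}x)\}$ (which may, but need not, be all of $\mathcal M$); 2. $\phi$ has no model $\mathcal M$ in which the field of $<^{\mathcal M}$ has cardinality $\lambda^+$; 3. $\phi$ has a model $\mathcal M$ that contains a strictly $<^{\mathcal M}$-increasing sequence of length $\lambda$ (indexed by the initial ordinal $\lambda$). Then $2^{\lambda}$ is characterizable. -/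

import Mathlib

open Cardinal

universe u v w

/-- Formulas of the infinitary logic `L_{ω₁,ω}` over the language `L`, with free variables among
`x₀, …, x_{n-1}`: atomic formulas, implication, quantification of one variable, and conjunction
of countably many formulas (a finite nonempty conjunction repeats its members). Negation,
countable disjunction and `∃` are obtained from `falsum`, `imp`, `conj` and `all`. -/
inductive InfFormula (L : FirstOrder.Language.{u, v}) : ℕ → Type (max u v)
  | falsum {n : ℕ} : InfFormula L n
  | equal {n : ℕ} (t₁ t₂ : L.Term (Fin n)) : InfFormula L n
  | rel {n k : ℕ} (R : L.Relations k) (ts : Fin k → L.Term (Fin n)) : InfFormula L n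
  | imp {n : ℕ} (φ ψ : InfFormula L n) : InfFormula L n
  | conj {n : ℕ} (φ : ℕ → InfFormula L n) : InfFormula L n
  | all {n : ℕ} (φ : InfFormula L (n + 1)) : InfFormula L n

/-- Sentences of `L_{ω₁,ω}`. -/
abbrev InfSentence (L : FirstOrder.Language.{u, v}) : Type (max u v) := InfFormula L 0

/-- Satisfaction of a formula of `L_{ω₁,ω}` in a structure under an assignment. -/
def InfFormula.Realize {L : FirstOrder.Language.{u, v}} (M : Type w) [L.Structure M] :
    {n : ℕ} → InfFormula L n → (Fin n → M) → Prop
  | _, .falsum, _ => False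
  | _, .equal t₁ t₂, a => t₁.realize a = t₂.realize a
  | _, .rel R ts, a => FirstOrder.Language.Structure.RelMap R (fun i => (ts i).realize a)
  | _, .imp φ ψ, a => φ.Realize M a → ψ.Realize M a
  | _, .conj φ, a => ∀ i, (φ i).Realize M a
  | _, .all φ, a => ∀ x : M, φ.Realize M (Fin.snoc a x)

/-- `M ⊨ φ` for a sentence `φ` of `L_{ω₁,ω}`. -/
def InfSentence.Models {L : FirstOrder.Language.{u, v}} (M : Type w) [L.Structure M]
    (φ : InfSentence L) : Prop :=
  InfFormula.Realize M φ Fin.elim0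

/-- A sentence of `L_{ω₁,ω}` is complete if it is satisfiable and decides every sentence of
`L_{ω₁,ω}` over the same language. Structures are nonempty, as usual. -/
def InfSentence.IsComplete {L : FirstOrder.Language.{u, v}} (φ : InfSentence L) : Prop :=
  (∃ (M : Type w) (_ : L.Structure M), Nonempty M ∧ φ.Models M) ∧
  ∀ ψ : InfSentence L,
    (∀ (M : Type w) [L.Structure M] [Nonempty M], φ.Models M → ψ.Models M) ∨
    (∀ (M : Type w) [L.Structure M] [Nonempty M], φ.Models M → ¬ ψ.Models M)

/-- `φ` has a model of cardinality `κ`. -/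
def InfSentence.HasModelOfCard {L : FirstOrder.Language.{u, v}} (φ : InfSentence L)
    (κ : Cardinal.{w}) : Prop :=
  ∃ (M : Type w) (_ : L.Structure M), Nonempty M ∧ φ.Models M ∧ #M = κ

/-- The infinite cardinal `κ` is (completely) characterizable: some complete `L_{ω₁,ω}`-sentence
in a countable language has models in all infinite cardinalities up to `κ`, but none in
cardinality `κ⁺`. -/
def IsCharacterizable (κ : Cardinal.{w}) : Prop :=
  ℵ₀ ≤ κ ∧
  ∃ (L : FirstOrder.Language.{0, 0}) (φ : InfSentence L), Countable L.Symbols ∧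
    InfSentence.IsComplete.{0, 0, w} φ ∧
    (∀ μ : Cardinal.{w}, ℵ₀ ≤ μ → μ ≤ κ → φ.HasModelOfCard μ) ∧
    ¬ φ.HasModelOfCard (Order.succ κ)

/-- The binary relation that a binary relation symbol denotes in a structure. -/
def binRel {L : FirstOrder.Language.{u, v}} (R : L.Relations 2) (M : Type w) [L.Structure M] :
    M → M → Prop :=
  fun x y => FirstOrder.Language.Structure.RelMap R ![x, y]

/-- The field of a binary relation: the elements that are related to some element. -/
def relField {M : Type w} (r : M → M → Prop) : Set M := {x | ∃ y, r x y ∨ r y x}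

/-- `r` is a strict linear order (of its field, which need not be all of `M`). -/
structure IsLinearOrderOnField {M : Type w} (r : M → M → Prop) : Prop where
  irrefl : ∀ x, ¬ r x x
  trans : ∀ x y z, r x y → r y z → r x z
  total : ∀ x ∈ relField r, ∀ y ∈ relField r, x ≠ y → r x y ∨ r y x

/-! Let F be the field of `<` in a model M of φ. Take a binary tree with levels ℕ × F, ordered
lexicographically, and a set W of its branches labelled by elements of M generically: off every
branch, at every level, splits a branch with any prescribed label. The structure lives on W alone: M
is W modulo equality of labels, and the level (n, f) is named by n and a branch labelled f.

Size: a branch is coded by a set of levels, so |W| ≤ 2^λ once |F| ≤ λ (`IsTreeOver.mk_le`,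
`InfSentence.mk_relField_le`). Equivalence: genericity lifts a back-and-forth system between base
structures to their trees (`IsTreeOver.exists_isBackForth`); conversely, a structure back-and-forth
equivalent to a tree is a tree over an equivalent base (`IsTreeOver.exists_of_isBackForth`).
Existence: branches can be taken to be sets of levels, splitting at their first difference. Finite
nonempty sets give a countable tree; over a model of size λ with an increasing λ-sequence,
well-ordered sets with a greatest element give at least 2^λ branches.

The witness is the Scott sentence of a countable tree over a countable model M₀ of φ. It is
complete, and its models are trees over models of φ, hence of size at most 2^λ. As φ is complete,
the base of the large tree is equivalent to M₀, so the large tree is a model too; Löwenheim–Skolem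
gives the smaller sizes. -/

namespace InfFormula

variable {L : FirstOrder.Language.{u, v}} {n : ℕ}

/-- Negation. -/
def neg (φ : InfFormula L n) : InfFormula L n := .imp φ .falsum

/-- Existential quantification. -/
def ex (φ : InfFormula L (n + 1)) : InfFormula L n := φ.neg.all.neg

open Classical in
/-- Conjunction of a family of formulas with a countable index type. -/
noncomputable def conjOver {ι : Type*} [Countable ι] (f : ι → InfFormula L n) : InfFormula L n :=
  if _h : Nonempty ι then .conj fun i => f ((exists_surjective_nat ι).choose i) else neg .falsum

/-- Disjunction of a family of formulas with a countable index type. -/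
noncomputable def disjOver {ι : Type*} [Countable ι] (f : ι → InfFormula L n) : InfFormula L n :=
  neg (conjOver fun i => neg (f i))

/-- Universal closure. -/
def alls : {n : ℕ} → InfFormula L n → InfSentence L
  | 0, φ => φ
  | _ + 1, φ => alls φ.all

section Realize

variable {M : Type w} [L.Structure M] {a : Fin n → M}

theorem realize_neg {φ : InfFormula L n} : φ.neg.Realize M a ↔ ¬ φ.Realize M a := Iff.rfl

theorem realize_imp {φ ψ : InfFormula L n} :
    (φ.imp ψ).Realize M a ↔ (φ.Realize M a → ψ.Realize M a) := Iff.rfl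

theorem realize_all {φ : InfFormula L (n + 1)} :
    φ.all.Realize M a ↔ ∀ x : M, φ.Realize M (Fin.snoc a x) := Iff.rfl

theorem realize_ex {φ : InfFormula L (n + 1)} :
    φ.ex.Realize M a ↔ ∃ x : M, φ.Realize M (Fin.snoc a x) := by
  simp only [ex, realize_neg, realize_all, not_forall, not_not]

theorem realize_conjOver {ι : Type*} [Countable ι] {f : ι → InfFormula L n} :
    (conjOver f).Realize M a ↔ ∀ i, (f i).Realize M a := by
  unfold conjOver
  split_ifs with h
  · exact ((exists_surjective_nat ι).choose_spec.forall (p := fun i => (f i).Realize M a)).symm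
  · rw [not_nonempty_iff] at h
    simp [realize_neg, Realize]

theorem realize_disjOver {ι : Type*} [Countable ι] {f : ι → InfFormula L n} :
    (disjOver f).Realize M a ↔ ∃ i, (f i).Realize M a := by
  simp only [disjOver, realize_neg, realize_conjOver, not_forall, not_not]

theorem models_alls : {n : ℕ} → {φ : InfFormula L n} →
    (φ.alls.Models M ↔ ∀ a : Fin n → M, φ.Realize M a)
  | 0, φ => by
    refine ⟨fun h a => ?_, fun h => h _⟩
    rwa [Subsingleton.elim a Fin.elim0]
  | n + 1, φ => by
    refine (models_alls (φ := φ.all)).trans ⟨fun h a => ?_, fun h a x => h _⟩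
    rw [← Fin.snoc_init_self a]
    exact h _ _

end Realize

end InfFormula

/-! ### Back-and-forth systems and infinitary equivalence. -/

/-- A system of partial maps between two structures, given by their graphs, with the
back-and-forth property. -/
structure IsBackForth (L : FirstOrder.Language.{u, v}) {A B : Type w} [L.Structure A]
    [L.Structure B] (S : Set (Set (A × B))) : Prop where
  forth : ∀ P ∈ S, ∀ a, ∃ Q ∈ S, P ⊆ Q ∧ ∃ b, (a, b) ∈ Q
  back : ∀ P ∈ S, ∀ b, ∃ Q ∈ S, P ⊆ Q ∧ ∃ a, (a, b) ∈ Q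
  eq_iff : ∀ P ∈ S, ∀ a b a' b', (a, b) ∈ P → (a', b') ∈ P → (a = a' ↔ b = b')
  rel_iff : ∀ P ∈ S, ∀ (k : ℕ) (R : L.Relations k) (x : Fin k → A) (y : Fin k → B),
    (∀ i, (x i, y i) ∈ P) →
      (FirstOrder.Language.Structure.RelMap R x ↔ FirstOrder.Language.Structure.RelMap R y)
  fun_iff : ∀ P ∈ S, ∀ (k : ℕ) (f : L.Functions k) (x : Fin k → A) (y : Fin k → B) (c : A) (d : B),
    (∀ i, (x i, y i) ∈ P) → (c, d) ∈ P →
      (FirstOrder.Language.Structure.funMap f x = c ↔ FirstOrder.Language.Structure.funMap f y = d)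

namespace IsBackForth

variable {L : FirstOrder.Language.{u, v}} {A B : Type w} [L.Structure A] [L.Structure B]
  {S : Set (Set (A × B))}

theorem forth_tuple (hS : IsBackForth L S) {k : ℕ} (x : Fin k → A) :
    ∀ P ∈ S, ∃ Q ∈ S, P ⊆ Q ∧ ∃ y : Fin k → B, ∀ i, (x i, y i) ∈ Q := by
  induction k with
  | zero => exact fun P hP => ⟨P, hP, subset_rfl, Fin.elim0, fun i => i.elim0⟩
  | succ k ih =>
    intro P hP
    obtain ⟨Q, hQ, hPQ, y, hy⟩ := ih (Fin.tail x) P hP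
    obtain ⟨R, hR, hQR, b, hb⟩ := hS.forth Q hQ (x 0)
    refine ⟨R, hR, hPQ.trans hQR, Fin.cons b y, fun i => ?_⟩
    refine Fin.cases ?_ (fun j => ?_) i
    · simpa using hb
    · simpa [Fin.tail] using hQR (hy j)

/-- `fun_iff` only speaks of a function applied to points already in the map, so the map is first
extended to the values of all subterms. -/
theorem realize_term (hS : IsBackForth L S) {α : Type*} (t : L.Term α) (a : α → A) (b : α → B) :
    ∀ P ∈ S, (∀ i, (a i, b i) ∈ P) → ∃ Q ∈ S, P ⊆ Q ∧ (t.realize a, t.realize b) ∈ Q := by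
  induction t with
  | var i => exact fun P hP h => ⟨P, hP, subset_rfl, h i⟩
  | @func l f ts ih =>
    intro P hP h
    have key : ∀ s : Finset (Fin l), ∃ Q ∈ S, P ⊆ Q ∧
        ∀ i ∈ s, ((ts i).realize a, (ts i).realize b) ∈ Q := by
      intro s
      induction s using Finset.induction_on with
      | empty => exact ⟨P, hP, subset_rfl, by simp⟩
      | insert j s _ ihs =>
        obtain ⟨Q, hQ, hPQ, hs⟩ := ihs
        obtain ⟨R, hR, hQR, hj⟩ := ih j Q hQ fun i => hPQ (h i)
        refine ⟨R, hR, hPQ.trans hQR, fun i hi => ?_⟩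
        rcases Finset.mem_insert.1 hi with rfl | hi
        · exact hj
        · exact hQR (hs i hi)
    obtain ⟨Q, hQ, hPQ, hs⟩ := key Finset.univ
    obtain ⟨R, hR, hQR, d, hd⟩ := hS.forth Q hQ ((FirstOrder.Language.Term.func f ts).realize a)
    refine ⟨R, hR, hPQ.trans hQR, ?_⟩
    have := (hS.fun_iff R hR l f (fun i => (ts i).realize a) (fun i => (ts i).realize b) _ d
      (fun i => hQR (hs i (Finset.mem_univ i))) hd).1 rfl
    rw [FirstOrder.Language.Term.realize_func f ts (v := b), this]
    exact hd

theorem realize_terms (hS : IsBackForth L S) {α : Type*} {k : ℕ} (ts : Fin k → L.Term α)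
    (a : α → A) (b : α → B) (P : Set (A × B)) (hP : P ∈ S) (h : ∀ i, (a i, b i) ∈ P) :
    ∃ Q ∈ S, P ⊆ Q ∧ ∀ i, ((ts i).realize a, (ts i).realize b) ∈ Q := by
  obtain ⟨Q, hQ, hPQ, y, hy⟩ := hS.forth_tuple (fun i => (ts i).realize a) P hP
  refine ⟨Q, hQ, hPQ, fun i => ?_⟩
  obtain ⟨R, hR, hQR, hi⟩ := hS.realize_term (ts i) a b Q hQ fun i => hPQ (h i)
  rw [(hS.eq_iff R hR _ _ _ _ hi (hQR (hy i))).1 rfl]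
  exact hy i

theorem realize_iff (hS : IsBackForth L S) {n : ℕ} (φ : InfFormula L n) :
    ∀ (a : Fin n → A) (b : Fin n → B), ∀ P ∈ S, (∀ i, (a i, b i) ∈ P) →
      (φ.Realize A a ↔ φ.Realize B b) := by
  induction φ with
  | falsum => exact fun _ _ _ _ _ => Iff.rfl
  | equal t₁ t₂ =>
    intro a b P hP h
    obtain ⟨Q, hQ, hPQ, h₁⟩ := hS.realize_term t₁ a b P hP h
    obtain ⟨R, hR, hQR, h₂⟩ := hS.realize_term t₂ a b Q hQ fun i => hPQ (h i)
    exact hS.eq_iff R hR _ _ _ _ (hQR h₁) h₂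
  | rel R ts =>
    intro a b P hP h
    obtain ⟨Q, hQ, hPQ, h'⟩ := hS.realize_terms ts a b P hP h
    exact hS.rel_iff Q hQ _ R _ _ h'
  | imp φ ψ ih₁ ih₂ => exact fun a b P hP h => imp_congr (ih₁ a b P hP h) (ih₂ a b P hP h)
  | conj φ ih => exact fun a b P hP h => forall_congr' fun i => ih i a b P hP h
  | all φ ih =>
    intro a b P hP h
    have snoc : ∀ Q, P ⊆ Q → ∀ c d, (c, d) ∈ Q →
        ∀ i, ((Fin.snoc a c : Fin _ → A) i, (Fin.snoc b d : Fin _ → B) i) ∈ Q := by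
      intro Q hPQ c d hcd i
      refine Fin.lastCases ?_ (fun j => ?_) i
      · simpa using hcd
      · simpa using hPQ (h j)
    constructor
    · intro H d
      obtain ⟨Q, hQ, hPQ, c, hc⟩ := hS.back P hP d
      exact (ih _ _ Q hQ (snoc Q hPQ c d hc)).1 (H c)
    · intro H c
      obtain ⟨Q, hQ, hPQ, d, hd⟩ := hS.forth P hP c
      exact (ih _ _ Q hQ (snoc Q hPQ c d hd)).2 (H d)

theorem models_iff (hS : IsBackForth L S) (hne : S.Nonempty) (φ : InfSentence L) :
    φ.Models A ↔ φ.Models B :=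
  hS.realize_iff φ _ _ hne.some hne.some_mem fun i => i.elim0

end IsBackForth

/-! ### Downward Löwenheim–Skolem for a single sentence. -/

section LowenheimSkolem

variable {L : FirstOrder.Language.{u, v}}

/-- A formula has only countably many subformulas; one function per universal subformula, returning
a counterexample when there is one, suffices. -/
theorem InfFormula.exists_skolem_family {n : ℕ} (φ : InfFormula L n) (M : Type w)
    [L.Structure M] [Nonempty M] :
    ∃ K : Set (Σ k : ℕ, (Fin k → M) → M), K.Countable ∧ ∀ N : L.Substructure M,
      (∀ g ∈ K, ∀ x : Fin g.1 → M, (∀ i, x i ∈ N) → g.2 x ∈ N) →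
      ∀ a : Fin n → N, φ.Realize N a ↔ φ.Realize M fun i => (a i : M) := by
  induction φ with
  | falsum => exact ⟨∅, Set.countable_empty, fun _ _ _ => Iff.rfl⟩
  | equal t₁ t₂ =>
    refine ⟨∅, Set.countable_empty, fun N _ a => ?_⟩
    have key : ∀ t : L.Term (Fin _), t.realize (fun i => (a i : M)) = (t.realize a : N) :=
      fun t => (FirstOrder.Language.HomClass.realize_term (F := FirstOrder.Language.Embedding L N M) N.subtype)
    simp only [InfFormula.Realize, key, Subtype.ext_iff]
  | rel R ts =>
    refine ⟨∅, Set.countable_empty, fun N _ a => ?_⟩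
    have key : ∀ t : L.Term (Fin _), t.realize (fun i => (a i : M)) = (t.realize a : N) :=
      fun t => (FirstOrder.Language.HomClass.realize_term (F := FirstOrder.Language.Embedding L N M) N.subtype)
    simp only [InfFormula.Realize, key]
    exact (N.subtype.map_rel R _).symm
  | imp φ ψ ih₁ ih₂ =>
    obtain ⟨K₁, hK₁, h₁⟩ := ih₁
    obtain ⟨K₂, hK₂, h₂⟩ := ih₂
    exact ⟨K₁ ∪ K₂, hK₁.union hK₂, fun N hN a =>
      imp_congr (h₁ N (fun g hg => hN g (.inl hg)) a) (h₂ N (fun g hg => hN g (.inr hg)) a)⟩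
  | conj φ ih =>
    choose K hK h using ih
    exact ⟨⋃ i, K i, Set.countable_iUnion hK, fun N hN a => forall_congr' fun i =>
      h i N (fun g hg => hN g (Set.mem_iUnion.2 ⟨i, hg⟩)) a⟩
  | @all m φ ih =>
    obtain ⟨K, hK, h⟩ := ih
    have hw : ∀ a : Fin m → M, ∃ x : M, φ.Realize M (Fin.snoc a x) → φ.all.Realize M a := by
      intro a
      by_cases H : φ.all.Realize M a
      · exact ⟨Classical.arbitrary M, fun _ => H⟩
      · obtain ⟨x, hx⟩ := not_forall.1 H
        exact ⟨x, fun h => (hx h).elim⟩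
    choose w hw using hw
    refine ⟨insert ⟨m, w⟩ K, hK.insert _, fun N hN a => ?_⟩
    have hφ := h N fun g hg => hN g (.inr hg)
    have snoc : ∀ x : N, (fun i => ((Fin.snoc a x : Fin _ → N) i : M)) =
        Fin.snoc (fun i => (a i : M)) (x : M) := by
      intro x
      ext i
      refine Fin.lastCases ?_ (fun j => ?_) i <;> simp
    constructor
    · intro H
      apply hw
      have := (hφ _).1 (H ⟨w fun i => (a i : M), hN _ (.inl rfl) _ fun i => (a i).2⟩)
      rwa [snoc] at this
    · intro H x
      rw [hφ, snoc]
      exact H x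

theorem InfSentence.exists_substructure {M : Type w} [L.Structure M]
    (hL : Countable L.Symbols) (φ : InfSentence L) (hφ : φ.Models M) (X : Set M) (hX : ℵ₀ ≤ #X) :
    ∃ N : L.Substructure M, X ⊆ N ∧ #N = #X ∧ φ.Models N := by
  have : Nonempty M := by
    have : Infinite X := Cardinal.infinite_iff.2 hX
    exact ⟨(Classical.arbitrary X : X)⟩
  obtain ⟨K, hK, h⟩ := φ.exists_skolem_family M
  let J : FirstOrder.Language.{max u w, 0} :=
    ⟨fun k => L.Functions k ⊕ {g : (Fin k → M) → M // (⟨k, g⟩ : Σ k : ℕ, (Fin k → M) → M) ∈ K},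
      fun _ => Empty⟩
  let _ : J.Structure M :=
    { funMap := fun {k} f => Sum.elim (fun f => FirstOrder.Language.Structure.funMap f)
        (fun g => g.1) f
      RelMap := fun R => R.elim }
  have hJ : Countable (Σ k, J.Functions k) := by
    have : Countable K := hK.to_subtype
    have : Countable (Σ k, L.Functions k) :=
      Function.Injective.countable (f := fun x => (Sum.inl x : L.Symbols)) Sum.inl_injective
    refine Function.Injective.countable (β := (Σ k, L.Functions k) ⊕ K)
      (f := fun x => Sum.map (fun f => ⟨x.1, f⟩) (fun g => ⟨⟨x.1, g.1⟩, g.2⟩) x.2) ?_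
    rintro ⟨k, f | g⟩ ⟨k', f' | g'⟩ hfg
    · simp only [Sum.map_inl, Sum.inl.injEq, Sigma.mk.injEq] at hfg
      obtain ⟨rfl, hfg⟩ := hfg
      rw [eq_of_heq hfg]
    · simp at hfg
    · simp at hfg
    · simp only [Sum.map_inr, Sum.inr.injEq, Subtype.mk.injEq, Sigma.mk.injEq] at hfg
      obtain ⟨rfl, hfg⟩ := hfg
      obtain rfl := Subtype.ext (eq_of_heq hfg)
      rfl
  let N₀ : J.Substructure M := FirstOrder.Language.Substructure.closure J X
  let N : L.Substructure M := ⟨N₀, fun {k} f x hx => N₀.fun_mem (Sum.inl f : J.Functions k) x hx⟩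
  have hXN : X ⊆ N := FirstOrder.Language.Substructure.subset_closure
  refine ⟨N, hXN, le_antisymm ?_ (Cardinal.mk_le_mk_of_subset hXN), ?_⟩
  · have := FirstOrder.Language.Substructure.lift_card_closure_le (L := J) (s := X)
    have hc : #(Σ k, J.Functions k) ≤ ℵ₀ := Cardinal.mk_le_aleph0
    have hle : Cardinal.lift.{max u w} #X + Cardinal.lift.{w} #(Σ k, J.Functions k) ≤
        Cardinal.lift.{max u w} #X := by
      refine Cardinal.add_le_of_le (by simpa using hX) le_rfl ?_
      exact (Cardinal.lift_le_aleph0.2 hc).trans (by simpa using hX)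
    have h2 := this.trans (max_le (by simpa using hX) hle)
    exact Cardinal.lift_le.1 h2
  · refine (h N (fun g hg x hx => N₀.fun_mem (Sum.inr ⟨g.2, hg⟩ : J.Functions g.1) x hx)
      Fin.elim0).2 ?_
    unfold InfSentence.Models at hφ
    convert hφ using 1

end LowenheimSkolem

/-! ### Scott sentences of countable structures. -/

section Scott

variable {L : FirstOrder.Language.{u, v}}

namespace InfFormula

variable {A : Type w} [L.Structure A] {n : ℕ}

/-- Two tuples of `A` satisfy the same formulas. -/
def SameType (L : FirstOrder.Language.{u, v}) {A : Type w} [L.Structure A] {n : ℕ}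
    (a b : Fin n → A) : Prop :=
  ∀ χ : InfFormula L n, χ.Realize A a ↔ χ.Realize A b

/-- There are only countably many tuples b, so the formulas separating a from each of them can be
conjoined. -/
theorem exists_isolating [Countable A] (a : Fin n → A) :
    ∃ ψ : InfFormula L n, ψ.Realize A a ∧ ∀ b, ψ.Realize A b → SameType L a b := by
  have : ∀ b : Fin n → A, ∃ χ : InfFormula L n, χ.Realize A a ∧
      (χ.Realize A b → SameType L a b) := by
    intro b
    by_cases h : SameType L a b
    · exact ⟨neg falsum, id, fun _ => h⟩
    · obtain ⟨χ, hχ⟩ := not_forall.1 h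
      by_cases ha : χ.Realize A a
      · exact ⟨χ, ha, fun hb => (hχ (iff_of_true ha hb)).elim⟩
      · exact ⟨χ.neg, ha, fun hb => (hχ (iff_of_false ha hb)).elim⟩
  choose χ h₁ h₂ using this
  exact ⟨conjOver χ, realize_conjOver.2 h₁, fun b hb => h₂ b (realize_conjOver.1 hb b)⟩

theorem exists_diagram {ι : Type*} [Countable ι] (θ : ι → InfFormula L n) (a : Fin n → A) :
    ∃ χ : InfFormula L n, ∀ (B : Type w) [L.Structure B] (b : Fin n → B),
      χ.Realize B b ↔ ∀ i, ((θ i).Realize B b ↔ (θ i).Realize A a) := by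
  classical
  refine ⟨conjOver fun i => if (θ i).Realize A a then θ i else (θ i).neg, fun B _ b => ?_⟩
  rw [realize_conjOver]
  refine forall_congr' fun i => ?_
  split_ifs with h <;> simp [h, realize_neg]

/-- The equations and relations between variables, and the equations between a function symbol
applied to variables and a variable. -/
def basic : (Fin n × Fin n) ⊕ (Σ k, L.Relations k × (Fin k → Fin n)) ⊕
    (Σ k, L.Functions k × (Fin k → Fin n) × Fin n) → InfFormula L n
  | .inl p => .equal (.var p.1) (.var p.2)
  | .inr (.inl ⟨_, R, s⟩) => .rel R fun i => .var (s i)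
  | .inr (.inr ⟨_, f, s, j⟩) => .equal (.func f fun i => .var (s i)) (.var j)

end InfFormula

open InfFormula in
-- Isolating formulas replace the usual induction on Scott rank. The sentence says that a tuple
-- satisfying the formula of a has the basic diagram of a and the same one-point extensions; the
-- finite maps matching such tuples then form the system.
theorem InfSentence.exists_scott (hL : Countable L.Symbols) (A : Type w) [Countable A]
    [L.Structure A] :
    ∃ σ : InfSentence L, σ.Models A ∧ ∀ (B : Type w) [L.Structure B], σ.Models B →
      ∃ S : Set (Set (B × A)), S.Nonempty ∧ IsBackForth L S := by
  have hF : ∀ k, Countable (L.Functions k) := fun k =>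
    Function.Injective.countable (f := fun x => (Sum.inl ⟨k, x⟩ : L.Symbols)) fun x y h => by
      simpa using h
  have hR : ∀ k, Countable (L.Relations k) := fun k =>
    Function.Injective.countable (f := fun x => (Sum.inr ⟨k, x⟩ : L.Symbols)) fun x y h => by
      simpa using h
  choose ψ hψ₁ hψ₂ using fun (n : ℕ) (a : Fin n → A) => exists_isolating (L := L) a
  choose χ hχ using fun (n : ℕ) (a : Fin n → A) => exists_diagram (basic (L := L)) a
  let τ (p : Σ n, Fin n → A) : Fin 3 → InfFormula L p.1 :=
    ![χ p.1 p.2, conjOver fun c : A => (ψ (p.1 + 1) (Fin.snoc p.2 c)).ex,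
      (disjOver fun c : A => ψ (p.1 + 1) (Fin.snoc p.2 c)).all]
  let ρ : Option (Σ n, Fin n → A) → InfSentence L := fun o =>
    o.elim (ψ 0 Fin.elim0) fun p => ((ψ p.1 p.2).imp (conjOver (τ p))).alls
  have key : ∀ (B : Type w) [L.Structure B], (conjOver ρ).Realize B Fin.elim0 ↔
      (ψ 0 Fin.elim0).Realize B Fin.elim0 ∧ ∀ (n : ℕ) (a : Fin n → A) (b : Fin n → B),
        (ψ n a).Realize B b → (χ n a).Realize B b ∧
          (∀ c, ∃ d, (ψ (n + 1) (Fin.snoc a c)).Realize B (Fin.snoc b d)) ∧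
          ∀ d, ∃ c, (ψ (n + 1) (Fin.snoc a c)).Realize B (Fin.snoc b d) := by
    intro B _
    rw [realize_conjOver, Option.forall]
    refine and_congr Iff.rfl ?_
    rw [Sigma.forall]
    refine forall₂_congr fun n a => ?_
    refine models_alls.trans (forall_congr' fun b => ?_)
    rw [realize_imp, realize_conjOver]
    simp only [τ, Fin.forall_fin_succ, realize_conjOver, realize_ex,
      realize_all, realize_disjOver, Matrix.cons_val_zero, Matrix.cons_val_succ, IsEmpty.forall_iff,
      and_true]
  refine ⟨conjOver ρ, (key A).2 ⟨hψ₁ _ _, fun n a b hb => ?_⟩, fun B _ hB => ?_⟩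
  · have hab := hψ₂ n a b hb
    refine ⟨(hab _).1 ((hχ n a A a).2 fun _ => Iff.rfl), fun c => ?_, fun d => ?_⟩
    · refine realize_ex.1 ((hab _).1 (realize_ex.2 ⟨c, hψ₁ _ _⟩))
    · obtain ⟨c, hc⟩ := realize_ex.1 ((hab _).2 (realize_ex.2 ⟨d, hψ₁ _ (Fin.snoc b d)⟩))
      exact ⟨c, (hψ₂ _ _ _ hc _).2 (hψ₁ _ _)⟩
  · obtain ⟨h₀, h⟩ := (key B).1 hB
    refine ⟨{P | ∃ (n : ℕ) (a : Fin n → A) (b : Fin n → B), (ψ n a).Realize B b ∧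
      P = Set.range fun i => (b i, a i)}, ⟨_, 0, _, _, h₀, rfl⟩, ?_⟩
    have sub : ∀ (n : ℕ) (a : Fin n → A) (b : Fin n → B) c d,
        (Set.range fun i => (b i, a i)) ⊆ (Set.range fun i : Fin (n + 1) =>
          ((Fin.snoc b d : Fin _ → B) i, (Fin.snoc a c : Fin _ → A) i)) ∧
        ((d, c) ∈ (Set.range fun i : Fin (n + 1) =>
          ((Fin.snoc b d : Fin _ → B) i, (Fin.snoc a c : Fin _ → A) i))) := by
      refine fun n a b c d => ⟨?_, ⟨Fin.last n, by simp⟩⟩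
      rintro _ ⟨i, rfl⟩
      exact ⟨i.castSucc, by simp⟩
    constructor
    · rintro _ ⟨n, a, b, hab, rfl⟩ d
      obtain ⟨c, hc⟩ := (h n a b hab).2.2 d
      exact ⟨_, ⟨n + 1, _, _, hc, rfl⟩, (sub n a b c d).1, c, (sub n a b c d).2⟩
    · rintro _ ⟨n, a, b, hab, rfl⟩ c
      obtain ⟨d, hc⟩ := (h n a b hab).2.1 c
      exact ⟨_, ⟨n + 1, _, _, hc, rfl⟩, (sub n a b c d).1, d, (sub n a b c d).2⟩
    · rintro _ ⟨n, a, b, hab, rfl⟩ d c d' c' ⟨i, hi⟩ ⟨j, hj⟩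
      obtain ⟨rfl, rfl⟩ := Prod.mk.inj hi
      obtain ⟨rfl, rfl⟩ := Prod.mk.inj hj
      exact (hχ n a B b).1 (h n a b hab).1 (.inl (i, j))
    · rintro _ ⟨n, a, b, hab, rfl⟩ k R x y hxy
      choose s hs using hxy
      obtain rfl : (fun i => b (s i)) = x := funext fun i => (Prod.mk.inj (hs i)).1
      obtain rfl : (fun i => a (s i)) = y := funext fun i => (Prod.mk.inj (hs i)).2
      exact (hχ n a B b).1 (h n a b hab).1 (.inr (.inl ⟨k, R, s⟩))
    · rintro _ ⟨n, a, b, hab, rfl⟩ k f x y d c hxy ⟨j, hj⟩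
      choose s hs using hxy
      obtain rfl : (fun i => b (s i)) = x := funext fun i => (Prod.mk.inj (hs i)).1
      obtain rfl : (fun i => a (s i)) = y := funext fun i => (Prod.mk.inj (hs i)).2
      obtain ⟨rfl, rfl⟩ := Prod.mk.inj hj
      exact (hχ n a B b).1 (h n a b hab).1 (.inr (.inr ⟨k, f, s, j⟩))

end Scott

theorem IsBackForth.symm {L : FirstOrder.Language.{u, v}} {A B : Type w} [L.Structure A]
    [L.Structure B] {S : Set (Set (A × B))} (hS : IsBackForth L S) :
    IsBackForth L {P : Set (B × A) | Prod.swap ⁻¹' P ∈ S} where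
  forth P hP b := by
    obtain ⟨Q, hQ, hPQ, a, ha⟩ := hS.back _ hP b
    exact ⟨Prod.swap ⁻¹' Q, hQ, fun x hx => hPQ (a := x.swap) hx, a, ha⟩
  back P hP a := by
    obtain ⟨Q, hQ, hPQ, b, hb⟩ := hS.forth _ hP a
    exact ⟨Prod.swap ⁻¹' Q, hQ, fun x hx => hPQ (a := x.swap) hx, b, hb⟩
  eq_iff P hP b a b' a' h h' := (hS.eq_iff _ hP a b a' b' h h').symm
  rel_iff P hP k R x y h := (hS.rel_iff _ hP k R y x h).symm
  fun_iff P hP k f x y c d h h' := (hS.fun_iff _ hP k f y x d c h h').symm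

/-! ### Labelled trees and their cardinality bound. -/

/-- The lexicographic order on pairs whose second components are compared by `r`. -/
def LexLt {M : Type w} (r : M → M → Prop) (p q : ℕ × M) : Prop :=
  p.1 < q.1 ∨ p.1 = q.1 ∧ r p.2 q.2

section LexLt

variable {M : Type w} {r : M → M → Prop}

theorem IsLinearOrderOnField.lexLt_irrefl (hr : IsLinearOrderOnField r) (p : ℕ × M) :
    ¬ LexLt r p p := by
  rintro (h | ⟨_, h⟩)
  · exact lt_irrefl _ h
  · exact hr.irrefl _ h

theorem IsLinearOrderOnField.lexLt_trans (hr : IsLinearOrderOnField r) {p q s : ℕ × M}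
    (h : LexLt r p q) (h' : LexLt r q s) : LexLt r p s := by
  rcases h with h | ⟨h, h₂⟩ <;> rcases h' with h' | ⟨h', h₂'⟩
  · exact .inl (h.trans h')
  · exact .inl (h' ▸ h)
  · exact .inl (h ▸ h')
  · exact .inr ⟨h.trans h', hr.trans _ _ _ h₂ h₂'⟩

theorem IsLinearOrderOnField.lexLt_total (hr : IsLinearOrderOnField r) {p q : ℕ × M}
    (hp : p.2 ∈ relField r) (hq : q.2 ∈ relField r) : LexLt r p q ∨ p = q ∨ LexLt r q p := by
  rcases lt_trichotomy p.1 q.1 with h | h | h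
  · exact .inl (.inl h)
  · by_cases h' : p.2 = q.2
    · exact .inr (.inl (Prod.ext h h'))
    · exact (hr.total _ hp _ hq h').elim (fun h₂ => .inl (.inr ⟨h, h₂⟩))
        fun h₂ => .inr (.inr (.inr ⟨h.symm, h₂⟩))
  · exact .inr (.inr (.inl h))

end LexLt

/-- `W` is the set of branches of a binary tree with levels in `ℕ × F`, ordered lexicographically,
where `F` is the field of `r`, and `h` labels the branches by elements of `M` in a generic way.
Here `D x y p` says that the branches `x` and `y` split at level `p`. -/
structure IsTreeOver {M W : Type w} (r : M → M → Prop) (h : W → M)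
    (D : W → W → ℕ × M → Prop) : Prop where
  surj : Function.Surjective h
  ne : ∀ {x y p}, D x y p → x ≠ y
  field : ∀ {x y p}, D x y p → p.2 ∈ relField r
  symm : ∀ {x y p}, D x y p → D y x p
  exists_split : ∀ {x y}, x ≠ y → ∃ p, D x y p
  unique : ∀ {x y p q}, D x y p → D x y q → p = q
  ultra : ∀ {x y z p q}, D x y p → D y z q → LexLt r p q → D x z p
  binary : ∀ {x y z p}, D x y p → D y z p → x ≠ z → ∃ q, D x z q ∧ LexLt r p q
  generic : ∀ x n, ∀ m ∈ relField r, ∀ c, ∃ y, D x y (n, m) ∧ h y = c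

/-- `C x p` is the ball of branches not leaving x before p, and `e x p` a representative depending
only on the ball. The code `l x` records the levels at which x leaves the representative. If x and y
split at p, they share the ball there, and by binarity exactly one of them leaves its representative
at p. -/
theorem IsTreeOver.mk_le {M W : Type w} {r : M → M → Prop} {h : W → M}
    {D : W → W → ℕ × M → Prop} (hW : IsTreeOver r h D) (hr : IsLinearOrderOnField r)
    {lam : Cardinal.{w}} (hlam : ℵ₀ ≤ lam) (hF : #(relField r) ≤ lam) :
    #W ≤ 2 ^ lam := by
  classical
  let C (x : W) (p : ℕ × M) : Set W := {z | ∀ q, D x z q → ¬ LexLt r q p}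
  have hC : ∀ x p, (C x p).Nonempty := fun x p => ⟨x, fun q hq => (hW.ne hq rfl).elim⟩
  have hsub : ∀ {x y p}, D x y p → C x p ⊆ C y p := by
    intro x y p hp z hz q hq hlt
    exact hz q (hW.symm (hW.ultra (hW.symm hq) (hW.symm hp) hlt)) hlt
  let e (x : W) (p : ℕ × M) : W := (hC x p).some
  have he : ∀ x p, e x p ∈ C x p := fun x p => (hC x p).some_mem
  have hee : ∀ {x y p}, D x y p → e x p = e y p := by
    intro x y p hp
    have : C x p = C y p := (hsub hp).antisymm (hsub (hW.symm hp))
    simp only [e, this]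
  let l (x : W) : Set (ℕ × relField r) := {p | D x (e x (p.1, p.2)) (p.1, p.2)}
  have step : ∀ {x y p}, D x y p → ¬ D x (e x p) p → D y (e y p) p := by
    intro x y p hp hx
    -- The representative is x or splits from x after p; either way y leaves it at p.
    by_cases hex : e x p = x
    · rw [← hee hp, hex]
      exact hW.symm hp
    · obtain ⟨q, hq⟩ := hW.exists_split (Ne.symm hex)
      rw [← hee hp]
      rcases hr.lexLt_total (hW.field hp) (hW.field hq) with h | rfl | h
      · exact hW.ultra (hW.symm hp) hq h
      · exact (hx hq).elim
      · exact (he x p q hq h).elim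
  have hl : Function.Injective l := by
    intro x y hxy
    by_contra hne
    obtain ⟨p, hp⟩ := hW.exists_split hne
    have hiff : D x (e x p) p ↔ D y (e y p) p :=
      Set.ext_iff.1 hxy (p.1, ⟨p.2, hW.field hp⟩)
    by_cases hx : D x (e x p) p
    · have hy := hiff.1 hx
      rw [hee hp] at hx
      obtain ⟨q, hq, hlt⟩ := hW.binary hx (hW.symm hy) hne
      rw [hW.unique hq hp] at hlt
      exact hr.lexLt_irrefl _ hlt
    · exact hx (hiff.2 (step hp hx))
  calc #W ≤ #(Set (ℕ × relField r)) := Cardinal.mk_le_of_injective hl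
    _ = 2 ^ #(ℕ × relField r) := Cardinal.mk_set
    _ ≤ 2 ^ lam := by
      refine Cardinal.power_le_power_left two_ne_zero ?_
      rw [Cardinal.mk_prod]
      refine Cardinal.mul_le_of_le hlam ?_ ?_
      · simpa using hlam
      · simpa using hF

/-! ### The one-sorted language of labelled trees. -/

/-- The relation symbols of the language of labelled trees over `L`-structures. -/
inductive TreeRel (L : FirstOrder.Language.{0, 0}) : ℕ → Type
  | rel {k : ℕ} (R : L.Relations k) : TreeRel L k
  | graph {k : ℕ} (f : L.Functions k) : TreeRel L (k + 1)
  | eqv : TreeRel L 2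
  | split (n : ℕ) : TreeRel L 3

/-- The relational language of labelled trees over `L`-structures. -/
def treeLanguage (L : FirstOrder.Language.{0, 0}) : FirstOrder.Language.{0, 0} :=
  ⟨fun _ => Empty, TreeRel L⟩

theorem countable_treeLanguage {L : FirstOrder.Language.{0, 0}} (hL : Countable L.Symbols) :
    Countable (treeLanguage L).Symbols := by
  have : Countable (Σ k, TreeRel L k) := by
    refine Function.Surjective.countable (α := L.Symbols ⊕ Option ℕ)
      (f := fun x => x.elim (fun s => s.elim (fun f => ⟨_, .graph f.2⟩) fun R => ⟨_, .rel R.2⟩)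
        fun o => o.elim ⟨_, .eqv⟩ fun n => ⟨_, .split n⟩) ?_
    rintro ⟨k, R | f | _ | n⟩
    · exact ⟨.inl (.inr ⟨_, R⟩), rfl⟩
    · exact ⟨.inl (.inl ⟨_, f⟩), rfl⟩
    · exact ⟨.inr none, rfl⟩
    · exact ⟨.inr (some n), rfl⟩
  have : IsEmpty (Σ k, (treeLanguage L).Functions k) := ⟨fun x => Empty.elim x.2⟩
  exact inferInstanceAs (Countable ((Σ k, (treeLanguage L).Functions k) ⊕ Σ k, TreeRel L k))

/-- The interpretation of the relation symbols of the language of labelled trees. -/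
def treeRelMap {L : FirstOrder.Language.{0, 0}} {M W : Type w} [L.Structure M] (h : W → M)
    (D : W → W → ℕ × M → Prop) : {k : ℕ} → TreeRel L k → (Fin k → W) → Prop
  | _, .rel R, x => FirstOrder.Language.Structure.RelMap R fun i => h (x i)
  | _, .graph f, x => FirstOrder.Language.Structure.funMap f (fun i => h (x (Fin.castSucc i))) =
      h (x (Fin.last _))
  | _, .eqv, x => h (x 0) = h (x 1)
  | _, .split n, x => D (x 0) (x 1) (n, h (x 2))

/-- A labelled tree over an `L`-structure as a structure. -/
@[reducible]
def treeStructure (L : FirstOrder.Language.{0, 0}) {M W : Type w} [L.Structure M] (h : W → M)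
    (D : W → W → ℕ × M → Prop) : (treeLanguage L).Structure W where
  funMap f := Empty.elim f
  RelMap R x := treeRelMap (L := L) h D R x

/-! ### Back-and-forth equivalence between trees and between their bases. -/

section BackForth

variable {L : FirstOrder.Language.{0, 0}} {M M₀ : Type w} [L.Structure M] [L.Structure M₀]
  {S : Set (Set (M × M₀))} {lt : L.Relations 2}

theorem IsBackForth.binRel_iff (hS : IsBackForth L S) {P : Set (M × M₀)} (hP : P ∈ S) {a a' b b'}
    (h : (a, b) ∈ P) (h' : (a', b') ∈ P) : binRel lt M a a' ↔ binRel lt M₀ b b' := by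
  refine hS.rel_iff P hP 2 lt _ _ fun i => ?_
  fin_cases i <;> assumption

theorem IsBackForth.lexLt_iff (hS : IsBackForth L S) {P : Set (M × M₀)} (hP : P ∈ S)
    {m n : ℕ} {a a' b b'} (h : (a, b) ∈ P) (h' : (a', b') ∈ P) :
    LexLt (binRel lt M) (m, a) (n, a') ↔ LexLt (binRel lt M₀) (m, b) (n, b') :=
  or_congr Iff.rfl (and_congr Iff.rfl (hS.binRel_iff hP h h'))

theorem IsBackForth.mem_relField (hS : IsBackForth L S) {P : Set (M × M₀)} (hP : P ∈ S) {a b}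
    (h : (a, b) ∈ P) (ha : a ∈ relField (binRel lt M)) : b ∈ relField (binRel lt M₀) := by
  obtain ⟨c, hc⟩ := ha
  obtain ⟨Q, hQ, hPQ, d, hd⟩ := hS.forth P hP c
  exact ⟨d, hc.imp (hS.binRel_iff hQ (hPQ h) hd).1 (hS.binRel_iff hQ hd (hPQ h)).1⟩

/-- The partial map `P` between trees is a partial isomorphism over the partial map `Q`. -/
structure TreeCompat {W W₀ : Type w} (h : W → M) (D : W → W → ℕ × M → Prop) (h₀ : W₀ → M₀)
    (D₀ : W₀ → W₀ → ℕ × M₀ → Prop) (P : Set (W × W₀)) (Q : Set (M × M₀)) : Prop where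
  label : ∀ {x y}, (x, y) ∈ P → (h x, h₀ y) ∈ Q
  eq_iff : ∀ {x y x' y'}, (x, y) ∈ P → (x', y') ∈ P → (x = x' ↔ y = y')
  split : ∀ {x y x' y' p}, (x, y) ∈ P → (x', y') ∈ P → D x x' p →
    ∃ g, (p.2, g) ∈ Q ∧ D₀ y y' (p.1, g)

variable {W W₀ : Type w} {h : W → M} {D : W → W → ℕ × M → Prop} {h₀ : W₀ → M₀}
    {D₀ : W₀ → W₀ → ℕ × M₀ → Prop} {P : Set (W × W₀)} {Q : Set (M × M₀)}

theorem TreeCompat.mono (H : TreeCompat h D h₀ D₀ P Q) {Q' : Set (M × M₀)} (hQ : Q ⊆ Q') :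
    TreeCompat h D h₀ D₀ P Q' where
  label hx := hQ (H.label hx)
  eq_iff := H.eq_iff
  split hx hx' hp := (H.split hx hx' hp).imp fun _ hg => ⟨hQ hg.1, hg.2⟩

/-- Splitting levels exist and are unique, so preservation of splits in one direction yields the
other. -/
theorem TreeCompat.swap (H : TreeCompat h D h₀ D₀ P Q) (hW : IsTreeOver (binRel lt M) h D)
    (hW₀ : IsTreeOver (binRel lt M₀) h₀ D₀) :
    TreeCompat h₀ D₀ h D (Prod.swap ⁻¹' P) (Prod.swap ⁻¹' Q) where
  label hx := H.label hx
  eq_iff hx hx' := (H.eq_iff hx hx').symm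
  split := by
    intro y x y' x' p hx hx' hp
    have hne : x ≠ x' := fun e => hW₀.ne hp ((H.eq_iff hx hx').1 e)
    obtain ⟨q, hq⟩ := hW.exists_split hne
    obtain ⟨g, hg, hD⟩ := H.split hx hx' hq
    obtain rfl := hW₀.unique hp hD
    exact ⟨q.2, hg, hq⟩

theorem IsTreeOver.exists_latest {r : M → M → Prop} (hW : IsTreeOver r h D)
    (hr : IsLinearOrderOnField r) (x : W) {T : Set W} (hT : T.Finite) (hne : T.Nonempty)
    (hx : x ∉ T) : ∃ a ∈ T, ∃ p, D x a p ∧ ∀ b ∈ T, ∀ q, D x b q → ¬ LexLt r p q := by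
  let s : T → T → Prop := fun a b => ∃ p q, D x a p ∧ D x b q ∧ LexLt r q p
  have : Finite T := hT
  have : IsTrans T s := ⟨by
    rintro a b c ⟨p, q, hp, hq, hlt⟩ ⟨q', t, hq', ht, hlt'⟩
    obtain rfl := hW.unique hq hq'
    exact ⟨p, t, hp, ht, hr.lexLt_trans hlt' hlt⟩⟩
  have : Std.Irrefl s := ⟨by
    rintro a ⟨p, q, hp, hq, hlt⟩
    obtain rfl := hW.unique hp hq
    exact hr.lexLt_irrefl _ hlt⟩
  have : Nonempty T := hne.to_subtype
  obtain ⟨a, -, ha⟩ := (Finite.wellFounded_of_trans_of_irrefl s).has_min Set.univ Set.univ_nonempty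
  obtain ⟨p, hp⟩ := hW.exists_split (x := x) (y := a) fun e => hx (e ▸ a.2)
  exact ⟨a, a.2, p, hp, fun b hb q hq hlt => ha ⟨b, hb⟩ trivial ⟨q, p, hq, hp, hlt⟩⟩

/-- Let a in the domain split from x as late as possible, at level (n, f). After adding f and the
label of x to the base map, genericity supplies a branch y leaving the image of a at the
corresponding level with the right label. The ultrametric law then determines all other splits of y.
-/
theorem TreeCompat.forth (hS : IsBackForth L S) (hlt : IsLinearOrderOnField (binRel lt M))
    (hW : IsTreeOver (binRel lt M) h D) (hW₀ : IsTreeOver (binRel lt M₀) h₀ D₀)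
    (H : TreeCompat h D h₀ D₀ P Q) (hP : P.Finite) (hQ : Q ∈ S) (x : W) :
    ∃ y, ∃ Q' ∈ S, TreeCompat h D h₀ D₀ (insert (x, y) P) Q' := by
  by_cases hx : ∃ y, (x, y) ∈ P
  · obtain ⟨y, hy⟩ := hx
    exact ⟨y, Q, hQ, by rwa [Set.insert_eq_of_mem hy]⟩
  rw [not_exists] at hx
  rcases P.eq_empty_or_nonempty with rfl | hne
  · obtain ⟨Q', hQ', -, m, hm⟩ := hS.forth Q hQ (h x)
    obtain ⟨y, rfl⟩ := hW₀.surj m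
    refine ⟨y, Q', hQ', ?_, ?_, ?_⟩
    · simpa using hm
    · simp +contextual
    · simp only [insert_empty_eq, Set.mem_singleton_iff, Prod.mk.injEq]
      rintro _ _ _ _ p ⟨rfl, rfl⟩ ⟨rfl, rfl⟩ hp
      exact (hW.ne hp rfl).elim
  obtain ⟨_, ⟨⟨a, b⟩, hab, rfl⟩, ⟨n, f⟩, hnf, hmax⟩ := hW.exists_latest hlt x (hP.image Prod.fst)
    (hne.image _) (by rintro ⟨⟨a, b⟩, hab, rfl⟩; exact hx _ hab)
  dsimp only at hnf
  obtain ⟨Q₁, hQ₁, hQQ₁, g, hg⟩ := hS.forth Q hQ f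
  obtain ⟨Q₂, hQ₂, hQQ₂, m, hm⟩ := hS.forth Q₁ hQ₁ (h x)
  replace hg := hQQ₂ hg
  replace H := H.mono (hQQ₁.trans hQQ₂)
  obtain ⟨y, hby, rfl⟩ := hW₀.generic b n g (hS.mem_relField hQ₂ hg (hW.field hnf)) m
  have claim : ∀ {x' y' p}, (x', y') ∈ P → D x x' p → ∃ g, (p.2, g) ∈ Q₂ ∧ D₀ y y' (p.1, g) := by
    intro x' y' p hx' hp
    by_cases hax : a = x'
    · subst hax
      obtain rfl := (H.eq_iff hab hx').1 rfl
      obtain rfl := hW.unique hnf hp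
      exact ⟨g, hg, hW₀.symm hby⟩
    obtain ⟨q, hq⟩ := hW.exists_split hax
    obtain ⟨g', hg', hD⟩ := H.split hab hx' hq
    rcases hlt.lexLt_total (hW.field hq) (hW.field hnf) with hl | rfl | hl
    · obtain rfl := hW.unique hp (hW.symm (hW.ultra (hW.symm hq) (hW.symm hnf) hl))
      exact ⟨g', hg', hW₀.symm (hW₀.ultra (hW₀.symm hD) hby ((hS.lexLt_iff hQ₂ hg' hg).1 hl))⟩
    -- Here x and x' leave a at the same level, so they split later from each other, against the
    -- choice of a.
    · obtain ⟨q', hq', hl⟩ := hW.binary hnf hq (fun e => hx y' (e ▸ hx'))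
      exact (hmax x' ⟨_, hx', rfl⟩ q' hq' hl).elim
    · obtain rfl := hW.unique hp (hW.ultra hnf hq hl)
      exact ⟨g, hg, hW₀.ultra (hW₀.symm hby) hD ((hS.lexLt_iff hQ₂ hg hg').1 hl)⟩
  have hyne : ∀ {x' y'}, (x', y') ∈ P → y ≠ y' := by
    intro x' y' hx'
    obtain ⟨p, hp⟩ := hW.exists_split (x := x) (y := x') (fun e => hx y' (e ▸ hx'))
    obtain ⟨_, _, hD⟩ := claim hx' hp
    exact hW₀.ne hD
  refine ⟨y, Q₂, hQ₂, ?_, ?_, ?_⟩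
  · rintro x' y' (hx' | hx')
    · obtain ⟨rfl, rfl⟩ := Prod.mk.inj hx'
      exact hm
    · exact H.label hx'
  · rintro x₁ y₁ x₂ y₂ (h₁ | h₁) (h₂ | h₂)
    · obtain ⟨rfl, rfl⟩ := Prod.mk.inj h₁
      obtain ⟨rfl, rfl⟩ := Prod.mk.inj h₂
      exact iff_of_true rfl rfl
    · obtain ⟨rfl, rfl⟩ := Prod.mk.inj h₁
      exact iff_of_false (fun e => hx y₂ (e ▸ h₂)) (hyne h₂)
    · obtain ⟨rfl, rfl⟩ := Prod.mk.inj h₂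
      exact iff_of_false (fun e => hx y₁ (e ▸ h₁)) (hyne h₁).symm
    · exact H.eq_iff h₁ h₂
  · rintro x₁ y₁ x₂ y₂ p (h₁ | h₁) (h₂ | h₂) hp
    · obtain ⟨rfl, rfl⟩ := Prod.mk.inj h₁
      obtain ⟨rfl, rfl⟩ := Prod.mk.inj h₂
      exact (hW.ne hp rfl).elim
    · obtain ⟨rfl, rfl⟩ := Prod.mk.inj h₁
      exact claim h₂ hp
    · obtain ⟨rfl, rfl⟩ := Prod.mk.inj h₂
      obtain ⟨g, hg, hD⟩ := claim h₁ (hW.symm hp)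
      exact ⟨g, hg, hW₀.symm hD⟩
    · exact H.split h₁ h₂ hp

theorem IsTreeOver.exists_isBackForth (hS : IsBackForth L S) (hne : S.Nonempty)
    (hlt : IsLinearOrderOnField (binRel lt M)) (hlt₀ : IsLinearOrderOnField (binRel lt M₀))
    (hW : IsTreeOver (binRel lt M) h D) (hW₀ : IsTreeOver (binRel lt M₀) h₀ D₀) :
    letI := treeStructure L h D
    letI := treeStructure L h₀ D₀
    ∃ T : Set (Set (W × W₀)), T.Nonempty ∧ IsBackForth (treeLanguage L) T := by
  let _ := treeStructure L h D
  let _ := treeStructure L h₀ D₀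
  have hsplit : ∀ {P Q}, Q ∈ S → TreeCompat h D h₀ D₀ P Q → ∀ {x y x' y' n u v}, (x, y) ∈ P →
      (x', y') ∈ P → (u, v) ∈ P → D x x' (n, h u) → D₀ y y' (n, h₀ v) := by
    intro P Q hQ H x y x' y' n u v hx hx' hu hD
    obtain ⟨g, hg, hD'⟩ := H.split hx hx' hD
    rwa [← (hS.eq_iff Q hQ _ _ _ _ hg (H.label hu)).1 rfl]
  refine ⟨{P | P.Finite ∧ ∃ Q ∈ S, TreeCompat h D h₀ D₀ P Q},
    ⟨∅, Set.finite_empty, hne.some, hne.some_mem, ⟨False.elim, False.elim, False.elim⟩⟩,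
    ?_, ?_, ?_, ?_, ?_⟩
  · rintro P ⟨hP, Q, hQ, H⟩ x
    obtain ⟨y, Q', hQ', H'⟩ := H.forth hS hlt hW hW₀ hP hQ x
    exact ⟨_, ⟨hP.insert _, Q', hQ', H'⟩, Set.subset_insert _ _, y, Set.mem_insert _ _⟩
  · rintro P ⟨hP, Q, hQ, H⟩ y
    obtain ⟨x, Q', hQ', H'⟩ := (H.swap hW hW₀).forth hS.symm hlt₀ hW₀ hW
      (hP.preimage Prod.swap_injective.injOn) hQ y
    refine ⟨insert (x, y) P, ⟨hP.insert _, Prod.swap ⁻¹' Q', hQ', ?_⟩, Set.subset_insert _ _, x,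
      Set.mem_insert _ _⟩
    convert H'.swap hW₀ hW using 1
    ext ⟨a, b⟩
    simp [and_comm]
  · rintro P ⟨-, Q, -, H⟩ x y x' y' hx hx'
    exact H.eq_iff hx hx'
  · rintro P ⟨-, Q, hQ, H⟩ k R x y hxy
    change treeRelMap (L := L) h D R x ↔ treeRelMap (L := L) h₀ D₀ R y
    cases R with
    | rel R => exact hS.rel_iff Q hQ _ R _ _ fun i => H.label (hxy i)
    | graph f =>
      exact hS.fun_iff Q hQ _ f _ _ _ _ (fun i => H.label (hxy _)) (H.label (hxy _))
    | eqv => exact hS.eq_iff Q hQ _ _ _ _ (H.label (hxy 0)) (H.label (hxy 1))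
    | split n =>
      refine ⟨hsplit hQ H (hxy 0) (hxy 1) (hxy 2), fun hD => ?_⟩
      obtain ⟨g, hg, hD'⟩ := (H.swap hW hW₀).split (hxy 0) (hxy 1) hD
      obtain rfl : g = h (x 2) := (hS.eq_iff Q hQ _ _ _ _ hg (H.label (hxy 2))).2 rfl
      exact hD'
  · rintro P - k f
    exact Empty.elim f

end BackForth

/-- The base is W modulo `eqv`, with functions read off their graphs. Each tree axiom concerns
finitely many branches and levels, so it transfers through a partial map containing them; images of
the partial maps under the labellings form the system between the bases. -/
theorem IsTreeOver.exists_of_isBackForth {L : FirstOrder.Language.{0, 0}} {M₀ W₀ : Type w}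
    [L.Structure M₀] {lt : L.Relations 2} {h₀ : W₀ → M₀} {D₀ : W₀ → W₀ → ℕ × M₀ → Prop}
    (hW₀ : IsTreeOver (binRel lt M₀) h₀ D₀) (W : Type w) [(treeLanguage L).Structure W]
    {S : Set (Set (W × W₀))} (hne : S.Nonempty)
    (hS : letI := treeStructure L h₀ D₀; IsBackForth (treeLanguage L) S) :
    ∃ (M : Type w) (_ : L.Structure M) (h : W → M) (D : W → W → ℕ × M → Prop),
      IsTreeOver (binRel lt M) h D ∧
      ∃ T : Set (Set (M × M₀)), T.Nonempty ∧ IsBackForth L T := by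
  let _ := treeStructure L h₀ D₀
  obtain ⟨P₀, hP₀⟩ := hne
  let E (x x' : W) : Prop :=
    FirstOrder.Language.Structure.RelMap (L := treeLanguage L) TreeRel.eqv ![x, x']
  let Sp (n : ℕ) (x x' u : W) : Prop := FirstOrder.Language.Structure.RelMap
    (L := treeLanguage L) (TreeRel.split n) ![x, x', u]
  have hE : ∀ {P}, P ∈ S → ∀ {x y x' y'}, (x, y) ∈ P → (x', y') ∈ P →
      (E x x' ↔ h₀ y = h₀ y') := by
    intro P hP x y x' y' hx hx'
    refine hS.rel_iff P hP 2 TreeRel.eqv ![x, x'] ![y, y'] fun i => ?_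
    fin_cases i <;> assumption
  have hSp : ∀ {P}, P ∈ S → ∀ {n x y x' y' u v}, (x, y) ∈ P → (x', y') ∈ P → (u, v) ∈ P →
      (Sp n x x' u ↔ D₀ y y' (n, h₀ v)) := by
    intro P hP n x y x' y' u v hx hx' hu
    refine hS.rel_iff P hP 3 (TreeRel.split n) ![x, x', u] ![y, y', v] fun i => ?_
    fin_cases i <;> assumption
  have two : ∀ x x' : W, ∃ P ∈ S, ∃ y y', (x, y) ∈ P ∧ (x', y') ∈ P := by
    intro x x'
    obtain ⟨P, hP, -, y, hy⟩ := hS.forth_tuple ![x, x'] P₀ hP₀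
    exact ⟨P, hP, y 0, y 1, hy 0, hy 1⟩
  have three : ∀ x x' x'' : W, ∃ P ∈ S, ∃ y y' y'', (x, y) ∈ P ∧ (x', y') ∈ P ∧ (x'', y'') ∈ P := by
    intro x x' x''
    obtain ⟨P, hP, -, y, hy⟩ := hS.forth_tuple ![x, x', x''] P₀ hP₀
    exact ⟨P, hP, y 0, y 1, y 2, hy 0, hy 1, hy 2⟩
  let s : Setoid W :=
    { r := E
      iseqv := by
        constructor
        · intro x
          obtain ⟨P, hP, y, y', hy, -⟩ := two x x
          exact (hE hP hy hy).2 rfl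
        · intro x x' hx
          obtain ⟨P, hP, y, y', hy, hy'⟩ := two x x'
          exact (hE hP hy' hy).2 ((hE hP hy hy').1 hx).symm
        · intro x x' x'' hx hx'
          obtain ⟨P, hP, y, y', y'', hy, hy', hy''⟩ := three x x' x''
          exact (hE hP hy hy'').2 (((hE hP hy hy').1 hx).trans ((hE hP hy' hy'').1 hx')) }
  let h : W → Quotient s := Quotient.mk s
  have hsurj : Function.Surjective h := Quotient.exists_rep
  have hh : ∀ {P}, P ∈ S → ∀ {x y x' y'}, (x, y) ∈ P → (x', y') ∈ P →
      (h x = h x' ↔ h₀ y = h₀ y') := fun hP _ _ _ _ hx hx' => Quotient.eq.trans (hE hP hx hx')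
  have hout : ∀ {P}, P ∈ S → ∀ {x y y'}, (x, y) ∈ P → ((h x).out, y') ∈ P → h₀ y' = h₀ y :=
    fun hP _ _ _ hx hx' => (hh hP hx' hx).1 (Quotient.out_eq _)
  have hG : ∀ (k : ℕ) (f : L.Functions k) (x : Fin k → W), ∃ c, ∀ P ∈ S, ∀ (y : Fin k → W₀) (d : W₀),
      (∀ i, (x i, y i) ∈ P) → (c, d) ∈ P →
      FirstOrder.Language.Structure.funMap f (fun i => h₀ (y i)) = h₀ d := by
    intro k f x
    obtain ⟨P, hP, -, y, hy⟩ := hS.forth_tuple x P₀ hP₀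
    obtain ⟨d, hd⟩ := hW₀.surj (FirstOrder.Language.Structure.funMap f fun i => h₀ (y i))
    obtain ⟨Q, hQ, hPQ, c, hc⟩ := hS.back P hP d
    have key : ∀ P ∈ S, ∀ (y : Fin k → W₀) (d : W₀), (∀ i, (x i, y i) ∈ P) → (c, d) ∈ P →
        (FirstOrder.Language.Structure.RelMap (L := treeLanguage L) (TreeRel.graph f)
          (Fin.snoc x c : Fin (k + 1) → W) ↔
        FirstOrder.Language.Structure.funMap f (fun i => h₀ (y i)) = h₀ d) := by
      intro P hP y d hy hd
      refine (hS.rel_iff P hP _ (TreeRel.graph f) (Fin.snoc x c : Fin (k + 1) → W)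
        (Fin.snoc y d : Fin (k + 1) → W₀) fun i => ?_).trans ?_
      · refine Fin.lastCases ?_ (fun j => ?_) i
        · simpa using hd
        · simpa using hy j
      · change treeRelMap (L := L) h₀ D₀ (TreeRel.graph f) _ ↔ _
        simp [treeRelMap]
    -- Whether `graph f` holds at (x, c) does not depend on the partial map, so one map establishing
    -- it serves for all.
    refine ⟨c, fun P' hP' y' d' hy' hd' => (key P' hP' y' d' hy' hd').1 ?_⟩
    exact (key Q hQ y d (fun i => hPQ (hy i)) hc).2 hd.symm
  choose G hG using hG
  let _ : L.Structure (Quotient s) :=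
    { funMap := fun {k} f m => h (G k f fun i => (m i).out)
      RelMap := fun {k} R m => FirstOrder.Language.Structure.RelMap
        (L := treeLanguage L) (TreeRel.rel R) fun i => (m i).out }
  let T : Set (Set (Quotient s × M₀)) := {Q | ∃ P ∈ S, Prod.map h h₀ '' P = Q}
  have hT : IsBackForth L T := by
    refine ⟨?_, ?_, ?_, ?_, ?_⟩
    · rintro _ ⟨P, hP, rfl⟩ a
      obtain ⟨x, rfl⟩ := hsurj a
      obtain ⟨Q, hQ, hPQ, y, hy⟩ := hS.forth P hP x
      exact ⟨_, ⟨Q, hQ, rfl⟩, Set.image_mono hPQ, h₀ y, _, hy, rfl⟩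
    · rintro _ ⟨P, hP, rfl⟩ b
      obtain ⟨y, rfl⟩ := hW₀.surj b
      obtain ⟨Q, hQ, hPQ, x, hx⟩ := hS.back P hP y
      exact ⟨_, ⟨Q, hQ, rfl⟩, Set.image_mono hPQ, h x, _, hx, rfl⟩
    · rintro _ ⟨P, hP, rfl⟩ a b a' b' ⟨⟨x, y⟩, hx, hxy⟩ ⟨⟨x', y'⟩, hx', hxy'⟩
      obtain ⟨rfl, rfl⟩ := Prod.mk.inj hxy
      obtain ⟨rfl, rfl⟩ := Prod.mk.inj hxy'
      exact hh hP hx hx'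
    · rintro _ ⟨P, hP, rfl⟩ k R m n hmn
      choose p hp hpe using hmn
      obtain rfl : (fun i => h (p i).1) = m := funext fun i => (Prod.mk.inj (hpe i)).1
      obtain rfl : (fun i => h₀ (p i).2) = n := funext fun i => (Prod.mk.inj (hpe i)).2
      obtain ⟨Q, hQ, hPQ, y, hy⟩ := hS.forth_tuple (fun i => (h (p i).1).out) P hP
      refine (hS.rel_iff Q hQ k (TreeRel.rel R) _ y hy).trans ?_
      change treeRelMap (L := L) h₀ D₀ (TreeRel.rel R) _ ↔ _
      simp only [treeRelMap, fun i => hout hQ (hPQ (hp i)) (hy i)]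
    · rintro _ ⟨P, hP, rfl⟩ k f m n c d hmn ⟨⟨x, x'⟩, hx, hxy⟩
      obtain ⟨rfl, rfl⟩ := Prod.mk.inj hxy
      choose p hp hpe using hmn
      obtain rfl : (fun i => h (p i).1) = m := funext fun i => (Prod.mk.inj (hpe i)).1
      obtain rfl : (fun i => h₀ (p i).2) = n := funext fun i => (Prod.mk.inj (hpe i)).2
      obtain ⟨Q, hQ, hPQ, y, hy⟩ := hS.forth_tuple (fun i => (h (p i).1).out) P hP
      obtain ⟨R, hR, hQR, z, hz⟩ := hS.forth Q hQ (G k f fun i => (h (p i).1).out)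
      have := hG k f _ R hR y z (fun i => hQR (hy i)) hz
      simp only [fun i => hout hQ (hPQ (hp i)) (hy i)] at this
      rw [this]
      exact hh hR hz (hQR (hPQ hx))
  let D (x x' : W) (p : ℕ × Quotient s) : Prop := ∃ u, Sp p.1 x x' u ∧ h u = p.2
  have hD : ∀ {P}, P ∈ S → ∀ {n x y x' y' u v}, (x, y) ∈ P → (x', y') ∈ P → (u, v) ∈ P →
      (D x x' (n, h u) ↔ D₀ y y' (n, h₀ v)) := by
    intro P hP n x y x' y' u v hx hx' hu
    refine ⟨?_, fun H => ⟨u, (hSp hP hx hx' hu).2 H, rfl⟩⟩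
    rintro ⟨t, ht, htu⟩
    obtain ⟨Q, hQ, hPQ, z, hz⟩ := hS.forth P hP t
    rw [← (hh hQ hz (hPQ hu)).1 htu]
    exact (hSp hQ (hPQ hx) (hPQ hx') hz).1 ht
  have mem : ∀ {P : Set (W × W₀)} {x y}, (x, y) ∈ P → (h x, h₀ y) ∈ Prod.map h h₀ '' P :=
    fun hx => ⟨_, hx, rfl⟩
  have hlex : ∀ {P}, P ∈ S → ∀ {m n x y x' y'}, (x, y) ∈ P → (x', y') ∈ P →
      (LexLt (binRel lt (Quotient s)) (m, h x) (n, h x') ↔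
        LexLt (binRel lt M₀) (m, h₀ y) (n, h₀ y')) :=
    fun hP _ _ _ _ _ _ hx hx' => hT.lexLt_iff ⟨_, hP, rfl⟩ (mem hx) (mem hx')
  refine ⟨Quotient s, inferInstance, h, D, ⟨hsurj, ?_, ?_, ?_, ?_, ?_, ?_, ?_, ?_⟩,
    T, ⟨_, P₀, hP₀, rfl⟩, hT⟩
  · rintro x x' ⟨n, m⟩ H rfl
    obtain ⟨u, rfl⟩ := hsurj m
    obtain ⟨P, hP, y, v, hy, hv⟩ := two x u
    exact hW₀.ne ((hD hP hy hy hv).1 H) rfl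
  · rintro x x' ⟨n, m⟩ H
    obtain ⟨u, rfl⟩ := hsurj m
    obtain ⟨P, hP, y, y', v, hy, hy', hv⟩ := three x x' u
    exact hT.symm.mem_relField (P := Prod.swap ⁻¹' (Prod.map h h₀ '' P)) ⟨P, hP, rfl⟩ (mem hv)
      (hW₀.field ((hD hP hy hy' hv).1 H))
  · rintro x x' ⟨n, m⟩ H
    obtain ⟨u, rfl⟩ := hsurj m
    obtain ⟨P, hP, y, y', v, hy, hy', hv⟩ := three x x' u
    exact (hD hP hy' hy hv).2 (hW₀.symm ((hD hP hy hy' hv).1 H))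
  · intro x x' H
    obtain ⟨P, hP, y, y', hy, hy'⟩ := two x x'
    obtain ⟨⟨n, m⟩, hm⟩ := hW₀.exists_split (fun e => H ((hS.eq_iff P hP _ _ _ _ hy hy').2 e))
    obtain ⟨v, rfl⟩ := hW₀.surj m
    obtain ⟨Q, hQ, hPQ, u, hu⟩ := hS.back P hP v
    exact ⟨(n, h u), (hD hQ (hPQ hy) (hPQ hy') hu).2 hm⟩
  · rintro x x' ⟨n, m⟩ ⟨n', m'⟩ H H'
    obtain ⟨u, rfl⟩ := hsurj m
    obtain ⟨u', rfl⟩ := hsurj m'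
    obtain ⟨P, hP, y, y', v, hy, hy', hv⟩ := three x x' u
    obtain ⟨Q, hQ, hPQ, v', hv'⟩ := hS.forth P hP u'
    obtain ⟨rfl, e⟩ := Prod.mk.inj (hW₀.unique ((hD hP hy hy' hv).1 H)
      ((hD hQ (hPQ hy) (hPQ hy') hv').1 H'))
    rw [(hh hQ (hPQ hv) hv').2 e]
  · rintro x x' x'' ⟨n, m⟩ ⟨n', m'⟩ H H' hl
    obtain ⟨u, rfl⟩ := hsurj m
    obtain ⟨u', rfl⟩ := hsurj m'
    obtain ⟨P, hP, y, y', y'', hy, hy', hy''⟩ := three x x' x''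
    obtain ⟨Q, hQ, hPQ, v, hv⟩ := hS.forth P hP u
    obtain ⟨R, hR, hQR, v', hv'⟩ := hS.forth Q hQ u'
    have hPR := hPQ.trans hQR
    exact (hD hR (hPR hy) (hPR hy'') (hQR hv)).2 (hW₀.ultra
      ((hD hR (hPR hy) (hPR hy') (hQR hv)).1 H) ((hD hR (hPR hy') (hPR hy'') hv').1 H')
      ((hlex hR (hQR hv) hv').1 hl))
  · rintro x x' x'' ⟨n, m⟩ H H' hx
    obtain ⟨u, rfl⟩ := hsurj m
    obtain ⟨P, hP, y, y', y'', hy, hy', hy''⟩ := three x x' x''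
    obtain ⟨Q, hQ, hPQ, v, hv⟩ := hS.forth P hP u
    obtain ⟨⟨n', m'⟩, hq, hl⟩ := hW₀.binary ((hD hQ (hPQ hy) (hPQ hy') hv).1 H)
      ((hD hQ (hPQ hy') (hPQ hy'') hv).1 H')
      (fun e => hx ((hS.eq_iff P hP _ _ _ _ hy hy'').2 e))
    obtain ⟨v', rfl⟩ := hW₀.surj m'
    obtain ⟨R, hR, hQR, u', hu'⟩ := hS.back Q hQ v'
    have hPR := hPQ.trans hQR
    exact ⟨(n', h u'), (hD hR (hPR hy) (hPR hy'') hu').2 hq, (hlex hR (hQR hv) hu').2 hl⟩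
  · intro x n m hm c
    obtain ⟨u, rfl⟩ := hsurj m
    obtain ⟨t, rfl⟩ := hsurj c
    obtain ⟨P, hP, y, v, t₀, hy, hv, ht⟩ := three x u t
    obtain ⟨y', hy', e⟩ := hW₀.generic y n (h₀ v)
      (hT.mem_relField (P := Prod.map h h₀ '' P) ⟨P, hP, rfl⟩ (mem hv) hm) (h₀ t₀)
    obtain ⟨Q, hQ, hPQ, x', hx'⟩ := hS.back P hP y'
    exact ⟨x', (hD hQ (hPQ hy) hx' (hPQ hv)).2 hy', (hh hQ hx' (hPQ ht)).2 e⟩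

/-! ### Trees whose branches are sets of levels. -/

/-- `p` is the first place where the sets `A` and `B` differ. -/
def SplitAt {X : Type w} [LT X] (A B : Set X) (p : X) : Prop :=
  ¬ (p ∈ A ↔ p ∈ B) ∧ ∀ q < p, (q ∈ A ↔ q ∈ B)

namespace SplitAt

variable {X : Type w} [LinearOrder X] {A B C : Set X} {p q : X}

theorem symm (h : SplitAt A B p) : SplitAt B A p :=
  ⟨fun e => h.1 e.symm, fun q hq => (h.2 q hq).symm⟩

theorem unique (h : SplitAt A B p) (h' : SplitAt A B q) : p = q := by
  rcases lt_trichotomy p q with hl | hl | hl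
  · exact (h.1 (h'.2 p hl)).elim
  · exact hl
  · exact (h'.1 (h.2 q hl)).elim

theorem trans_of_lt (h : SplitAt A B p) (h' : SplitAt B C q) (hpq : p < q) : SplitAt A C p :=
  ⟨fun e => h.1 (e.trans (h'.2 p hpq).symm),
    fun s hs => (h.2 s hs).trans (h'.2 s (hs.trans hpq))⟩

theorem lt_of_split (h : SplitAt A B p) (h' : SplitAt B C p) (hq : SplitAt A C q) : p < q := by
  rcases lt_trichotomy p q with hl | rfl | hl
  · exact hl
  -- Membership has two values, so three sets cannot differ pairwise at p.
  · have h₁ := h.1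
    have h₂ := h'.1
    have h₃ := hq.1
    tauto
  · exact (hq.1 ((h.2 q hl).trans (h'.2 q hl))).elim

/-- The symmetric difference lies in a union of two well-ordered sets, so it has a least element. -/
theorem exists_of_ne (hA : A.IsWF) (hB : B.IsWF) (hne : A ≠ B) : ∃ p, SplitAt A B p := by
  have hwf : (symmDiff A B).IsWF := (hA.union hB).mono Set.symmDiff_subset_union
  have hn : (symmDiff A B).Nonempty := Set.symmDiff_nonempty.2 hne
  refine ⟨hwf.min hn, ?_, fun q hq => ?_⟩
  · have := hwf.min_mem hn
    rw [Set.mem_symmDiff] at this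
    tauto
  · have := fun h : q ∈ symmDiff A B => hwf.not_lt_min hn h hq
    rw [Set.mem_symmDiff] at this
    tauto

end SplitAt

/-- The set that agrees with `A` below `p`, differs from it at `p`, and contains only `q` above. -/
def branchOff {X : Type w} [LT X] (A : Set X) (p q : X) : Set X :=
  {s | s < p ∧ s ∈ A ∨ s = p ∧ p ∉ A ∨ s = q}

theorem splitAt_branchOff {X : Type w} [LinearOrder X] (A : Set X) {p q : X} (h : p < q) :
    SplitAt A (branchOff A p q) p := by
  refine ⟨?_, fun s hs => ?_⟩
  · simp [branchOff, h.ne]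
  · simp [branchOff, hs, hs.ne, (hs.trans h).ne]

theorem isGreatest_branchOff {X : Type w} [LinearOrder X] (A : Set X) {p q : X} (h : p < q) :
    IsGreatest (branchOff A p q) q := by
  refine ⟨.inr (.inr rfl), ?_⟩
  rintro s (hs | hs | rfl)
  · exact (hs.1.trans h).le
  · exact hs.1 ▸ h.le
  · exact le_rfl

theorem branchOff_subset {X : Type w} [LinearOrder X] (A : Set X) (p q : X) :
    branchOff A p q ⊆ insert p (insert q A) := by
  rintro s (hs | hs | rfl)
  · exact .inr (.inr hs.2)
  · exact .inl hs.1
  · exact .inr (.inl rfl)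

/-- The linear order on the field of a relation. -/
@[reducible]
noncomputable def IsLinearOrderOnField.linearOrder {M : Type w} {r : M → M → Prop}
    (hr : IsLinearOrderOnField r) : LinearOrder (relField r) :=
  have : IsStrictTotalOrder (relField r) (fun a b => r a b) :=
    { irrefl := fun a => hr.irrefl a
      trans := fun a b c => hr.trans a b c
      trichotomous := fun a b h h' => by
        by_contra hne
        exact (hr.total a a.2 b b.2 (fun e => hne (Subtype.ext e))).elim h h' }
  haveI := Classical.decRel (fun a b : relField r => r a b)
  linearOrderOfSTO (fun a b : relField r => r a b)

/-- The label of a branch is read from its greatest element through β. `branchOff` changes A at p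
and then puts a chosen greatest element above p, so splitting level and label can be prescribed
independently. -/
theorem IsLinearOrderOnField.exists_isTreeOver {M : Type w} {r : M → M → Prop}
    (hr : IsLinearOrderOnField r) {β : relField r → M} (hβ : Function.Surjective β)
    (𝒱 : letI := hr.linearOrder; Set (Set (ℕ ×ₗ relField r)))
    (hne : 𝒱.Nonempty) (hwf : letI := hr.linearOrder; ∀ A ∈ 𝒱, A.IsWF)
    (hmax : letI := hr.linearOrder; ∀ A ∈ 𝒱, ∃ p, IsGreatest A p)
    (hoff : letI := hr.linearOrder; ∀ A ∈ 𝒱, ∀ p q, p < q → branchOff A p q ∈ 𝒱) :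
    ∃ (h : 𝒱 → M) (D : 𝒱 → 𝒱 → ℕ × M → Prop), IsTreeOver r h D := by
  let _ := hr.linearOrder
  have hlt : ∀ a b : relField r, a < b ↔ r a b := fun a b => Iff.rfl
  have hlex : ∀ {m n : ℕ} {a b : relField r}, LexLt r (m, a) (n, b) ↔
      toLex (m, a) < toLex (n, b) := by
    intro m n a b
    rw [Prod.Lex.toLex_lt_toLex, hlt]
    rfl
  choose g hg using fun A : 𝒱 => hmax A A.2
  have branch : ∀ (A : 𝒱) (n : ℕ) (f b : relField r), ∃ B : 𝒱,
      SplitAt (A : Set (ℕ ×ₗ relField r)) B (toLex (n, f)) ∧ g B = toLex (n + 1, b) := by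
    intro A n f b
    -- This is the purpose of the factor ℕ: above every level there is a copy of every field
    -- element.
    have hl : toLex (n, f) < toLex (n + 1, b) := by
      rw [Prod.Lex.toLex_lt_toLex]
      exact .inl n.lt_succ_self
    exact ⟨⟨_, hoff A A.2 _ _ hl⟩, splitAt_branchOff _ hl,
      (hg _).unique (isGreatest_branchOff _ hl)⟩
  refine ⟨fun A => β (ofLex (g A)).2, fun A B p => ∃ f : relField r, (f : M) = p.2 ∧
    SplitAt (A : Set (ℕ ×ₗ relField r)) B (toLex (p.1, f)), ?_, ?_, ?_, ?_, ?_, ?_, ?_, ?_, ?_⟩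
  · intro c
    obtain ⟨b, rfl⟩ := hβ c
    obtain ⟨A, hA⟩ := hne
    obtain ⟨B, -, hB⟩ := branch ⟨A, hA⟩ 0 b b
    exact ⟨B, congrArg (fun q => β (ofLex q).2) hB⟩
  · rintro A _ p ⟨f, -, hs⟩ rfl
    exact hs.1 Iff.rfl
  · rintro A B p ⟨f, hf, -⟩
    exact hf ▸ f.2
  · rintro A B p ⟨f, hf, hs⟩
    exact ⟨f, hf, hs.symm⟩
  · intro A B hAB
    obtain ⟨p, hp⟩ := SplitAt.exists_of_ne (hwf A A.2) (hwf B B.2) fun e => hAB (Subtype.ext e)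
    exact ⟨((ofLex p).1, (ofLex p).2), _, rfl, hp⟩
  · rintro A B ⟨n, _⟩ ⟨n', _⟩ ⟨f, rfl, hs⟩ ⟨f', rfl, hs'⟩
    obtain ⟨rfl, rfl⟩ := Prod.mk.inj (toLex.injective (hs.unique hs'))
    rfl
  · rintro A B C ⟨n, _⟩ ⟨n', _⟩ ⟨f, rfl, hs⟩ ⟨f', rfl, hs'⟩ hl
    exact ⟨f, rfl, hs.trans_of_lt hs' (hlex.1 hl)⟩
  · rintro A B C ⟨n, _⟩ ⟨f, rfl, hs⟩ ⟨f', hf', hs'⟩ hAC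
    obtain rfl := Subtype.ext hf'
    obtain ⟨q, hq⟩ := SplitAt.exists_of_ne (hwf A A.2) (hwf C C.2) fun e => hAC (Subtype.ext e)
    exact ⟨((ofLex q).1, (ofLex q).2), ⟨_, rfl, hq⟩, hlex.2 (hs.lt_of_split hs' hq)⟩
  · intro A n m hm c
    obtain ⟨b, rfl⟩ := hβ c
    obtain ⟨B, hs, hB⟩ := branch A n ⟨m, hm⟩ b
    exact ⟨B, ⟨⟨m, hm⟩, rfl, hs⟩, congrArg (fun q => β (ofLex q).2) hB⟩

theorem IsLinearOrderOnField.exists_countable_isTreeOver {M : Type w} [Countable M]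
    {r : M → M → Prop} (hr : IsLinearOrderOnField r) (hF : (relField r).Infinite) :
    ∃ (W : Type w) (_ : Countable W) (_ : Nonempty W) (h : W → M) (D : W → W → ℕ × M → Prop),
      IsTreeOver r h D := by
  let _ := hr.linearOrder
  have : Infinite (relField r) := hF.to_subtype
  obtain ⟨f⟩ : Nonempty (relField r) := inferInstance
  have : Nonempty M := ⟨f⟩
  obtain ⟨e⟩ : Nonempty (relField r ≃ ℕ) := nonempty_equiv_of_countable
  obtain ⟨β, hβ⟩ := exists_surjective_nat M
  let 𝒱 : Set (Set (ℕ ×ₗ relField r)) := {A | A.Finite ∧ A.Nonempty}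
  have hne : 𝒱.Nonempty := ⟨{toLex (0, f)}, Set.finite_singleton _, Set.singleton_nonempty _⟩
  have : Countable (ℕ ×ₗ relField r) := inferInstanceAs (Countable (ℕ × relField r))
  refine ⟨𝒱, (Set.Countable.ofPred_finite.mono fun A hA => hA.1).to_subtype, hne.to_subtype,
    hr.exists_isTreeOver (hβ.comp e.surjective) 𝒱 hne (fun A hA => hA.1.isWF) ?_ ?_⟩
  · intro A hA
    obtain ⟨p, hp, hmax⟩ := Set.exists_max_image A id hA.1 hA.2
    exact ⟨p, hp, hmax⟩
  · exact fun A hA p q hpq => ⟨((hA.1.insert q).insert p).subset (branchOff_subset A p q),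
      q, (isGreatest_branchOff A hpq).1⟩

/-- Every subset of the increasing λ-sequence is well-ordered, which gives 2^λ branches. The
sequence also makes the field as large as M, so that the field can carry all labels. -/
theorem IsLinearOrderOnField.exists_isTreeOver_two_power_le {M : Type w} {r : M → M → Prop}
    (hr : IsLinearOrderOnField r) {lam : Cardinal.{w}} (hlam : ℵ₀ ≤ lam) (hM : #M = lam)
    {s : lam.ord.ToType → M} (hs : ∀ i j, i < j → r (s i) (s j)) :
    ∃ (W : Type w) (h : W → M) (D : W → W → ℕ × M → Prop),
      IsTreeOver r h D ∧ 2 ^ lam ≤ #W := by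
  let _ := hr.linearOrder
  have hmem : ∀ i, s i ∈ relField r := by
    intro i
    have : NoMaxOrder lam.ord.ToType := Cardinal.noMaxOrder hlam
    obtain ⟨j, hj⟩ := exists_gt i
    exact ⟨s j, .inl (hs i j hj)⟩
  let t : lam.ord.ToType → relField r := fun i => ⟨s i, hmem i⟩
  have ht : StrictMono t := fun i j hij => hs i j hij
  have hcard : #lam.ord.ToType = lam := by simp
  obtain ⟨e⟩ : Nonempty (M ↪ relField r) := by
    rw [← Cardinal.le_def, hM, ← hcard]
    exact Cardinal.mk_le_of_injective ht.injective
  have : Nonempty lam.ord.ToType := by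
    rw [← Cardinal.mk_ne_zero_iff, hcard]
    exact (Cardinal.aleph0_pos.trans_le hlam).ne'
  obtain ⟨i₀⟩ := this
  have : Nonempty M := ⟨s i₀⟩
  let T (X : Set lam.ord.ToType) : Set (ℕ ×ₗ relField r) := (fun i => toLex (0, t i)) '' X
  have hmono : StrictMono fun i => toLex (0, t i) := fun i j hij =>
    Prod.Lex.toLex_lt_toLex.2 (.inr ⟨rfl, ht hij⟩)
  let 𝒱 : Set (Set (ℕ ×ₗ relField r)) := {A | A.IsWF ∧ ∃ p, IsGreatest A p}
  -- The point (1, t i₀) lies above the whole copy of the sequence at 0, providing a greatest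
  -- element for every X, even the empty set.
  have hT : ∀ X, insert (toLex (1, t i₀)) (T X) ∈ 𝒱 := by
    intro X
    refine ⟨?_, toLex (1, t i₀), Set.mem_insert _ _, ?_⟩
    · refine Set.IsWF.insert ?_ _
      exact ((Set.IsWF.of_wellFoundedLT X).isPWO.image_of_monotone hmono.monotone).isWF
    · rintro _ (rfl | ⟨i, -, rfl⟩)
      · exact le_rfl
      · exact (Prod.Lex.toLex_lt_toLex.2 (.inl Nat.one_pos)).le
  obtain ⟨h, D, hD⟩ := hr.exists_isTreeOver (Function.invFun_surjective e.injective) 𝒱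
    ⟨_, hT ∅⟩ (fun A hA => hA.1) (fun A hA => hA.2) fun A hA p q hpq =>
      ⟨((hA.1.insert q).insert p).mono (branchOff_subset A p q), q, isGreatest_branchOff A hpq⟩
  refine ⟨𝒱, h, D, hD, ?_⟩
  rw [← hcard, ← Cardinal.mk_set]
  refine Cardinal.mk_le_of_injective (f := fun X => (⟨_, hT X⟩ : 𝒱)) fun X Y hXY => ?_
  have hXY' := Subtype.ext_iff.1 hXY
  ext i
  have key : ∀ X, toLex (0, t i) ∈ insert (toLex (1, t i₀)) (T X) ↔ i ∈ X := by
    intro X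
    rw [Set.mem_insert_iff, or_iff_right]
    · exact hmono.injective.mem_set_image
    · exact fun e => by simpa using (Prod.mk.inj (toLex.injective e)).1
  exact (key X).symm.trans ((Set.ext_iff.1 hXY' _).trans (key Y))

/-! ### Models of φ of suitable size, and the final argument. -/

theorem InfSentence.exists_model_of_sequence {L : FirstOrder.Language.{0, 0}}
    (hL : Countable L.Symbols) {φ : InfSentence L} {lt : L.Relations 2}
    (hlin : ∀ (M : Type w) [L.Structure M] [Nonempty M], φ.Models M →
      IsLinearOrderOnField (binRel lt M)) {J : Type w} [LinearOrder J]
    {M : Type w} [L.Structure M] (hM : φ.Models M) {s : J → M}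
    (hs : ∀ i j, i < j → binRel lt M (s i) (s j)) (I : Set J) (hI : ℵ₀ ≤ #I) :
    ∃ (N : Type w) (_ : L.Structure N), Nonempty N ∧ φ.Models N ∧ #N = #I ∧
      ∃ t : I → N, ∀ i j, i < j → binRel lt N (t i) (t j) := by
  have : Infinite I := Cardinal.infinite_iff.2 hI
  obtain ⟨i₀⟩ : Nonempty I := inferInstance
  have : Nonempty M := ⟨s i₀⟩
  have hinj : Function.Injective s := by
    intro i j hij
    by_contra hne
    rcases lt_or_gt_of_ne hne with h | h
    · exact (hlin M hM).irrefl _ (hij ▸ hs _ _ h)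
    · exact (hlin M hM).irrefl _ (hij ▸ hs _ _ h)
  have hX : #(s '' I) = #I := Cardinal.mk_image_eq hinj
  obtain ⟨N, hN, hc, hφ⟩ := InfSentence.exists_substructure hL φ hM (s '' I) (hX ▸ hI)
  refine ⟨N, inferInstance, ⟨⟨s i₀, hN ⟨i₀, i₀.2, rfl⟩⟩⟩, hφ, hc.trans hX,
    fun i => ⟨s i, hN ⟨i, i.2, rfl⟩⟩, fun i j hij => ?_⟩
  have := hs i j hij
  unfold binRel at this ⊢
  rw [← N.subtype.map_rel]
  convert this using 1
  ext k
  fin_cases k <;> rfl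

/-- The hypothesis excludes only size λ⁺; a larger field is cut down to that size by
Löwenheim–Skolem around λ⁺ of its points. -/
theorem InfSentence.mk_relField_le {L : FirstOrder.Language.{0, 0}}
    (hL : Countable L.Symbols) {φ : InfSentence L} {lt : L.Relations 2} {lam : Cardinal.{w}}
    (hlam : ℵ₀ ≤ lam) (hlin : ∀ (M : Type w) [L.Structure M] [Nonempty M], φ.Models M →
      IsLinearOrderOnField (binRel lt M))
    (hbound : ∀ (M : Type w) [L.Structure M] [Nonempty M], φ.Models M →
      #(relField (binRel lt M)) ≠ Order.succ lam)
    {M : Type w} [L.Structure M] (hM : φ.Models M) : #(relField (binRel lt M)) ≤ lam := by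
  by_contra hlt
  rw [not_le, ← Order.succ_le_iff] at hlt
  obtain ⟨X, hXF, hX⟩ := Cardinal.le_mk_iff_exists_subset.1 hlt
  have hX' : ℵ₀ ≤ #X := hX ▸ hlam.trans (Order.le_succ lam)
  have : Infinite X := Cardinal.infinite_iff.2 hX'
  obtain ⟨N, hN, hc, hφ⟩ := InfSentence.exists_substructure hL φ hM X hX'
  obtain ⟨x₀⟩ : Nonempty X := inferInstance
  have : Nonempty M := ⟨x₀⟩
  have : Nonempty N := ⟨⟨x₀, hN x₀.2⟩⟩
  have hrel : ∀ a b : N, binRel lt M a b → binRel lt N a b := by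
    intro a b h
    unfold binRel at h ⊢
    rw [← N.subtype.map_rel]
    convert h using 1
    ext k
    fin_cases k <;> rfl
  refine hbound N hφ (le_antisymm ?_ ?_)
  · exact (Cardinal.mk_set_le _).trans (hc.trans hX).le
  · rw [← hX]
    have hmem : ∀ x : X, (⟨x, hN x.2⟩ : N) ∈ relField (binRel lt N) := by
      intro x
      -- A second point of X keeps x in the field of the smaller structure.
      obtain ⟨y, hy⟩ := exists_ne x
      refine ⟨⟨y, hN y.2⟩, ?_⟩
      exact ((hlin M hM).total x (hXF x.2) y (hXF y.2) fun e => hy (Subtype.ext e.symm)).imp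
        (hrel _ _) (hrel _ _)
    refine Cardinal.mk_le_of_injective (f := fun x : X => (⟨_, hmem x⟩ : relField (binRel lt N))) ?_
    intro x y hxy
    have := congrArg (fun z : relField (binRel lt N) => ((z : N) : M)) hxy
    exact Subtype.ext this

theorem mainTheorem3 (L : FirstOrder.Language.{0, 0}) (hL : Countable L.Symbols)
    (φ : InfSentence L) (hφ : InfSentence.IsComplete.{0, 0, w} φ)
    (lt : L.Relations 2) (lam : Cardinal.{w}) (hlam : ℵ₀ ≤ lam)
    (hlin : ∀ (M : Type w) [L.Structure M] [Nonempty M], φ.Models M →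
      IsLinearOrderOnField (binRel lt M))
    (hbound : ∀ (M : Type w) [L.Structure M] [Nonempty M], φ.Models M →
      #(relField (binRel lt M)) ≠ Order.succ lam)
    (hseq : ∃ (M : Type w) (_ : L.Structure M), Nonempty M ∧ φ.Models M ∧
      ∃ s : lam.ord.ToType → M, ∀ i j, i < j → binRel lt M (s i) (s j)) :
    IsCharacterizable ((2 : Cardinal.{w}) ^ lam) := by
  obtain ⟨M₁, _, _, hM₁, s, hs⟩ := hseq
  have hcard : #lam.ord.ToType = lam := by simp
  obtain ⟨I, hI⟩ := Cardinal.le_mk_iff_exists_set.1 (hlam.trans_eq hcard.symm)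
  -- A countable part of the sequence gives a countable model with infinite field; the whole
  -- sequence gives a model of size exactly λ.
  obtain ⟨M₀, _, _, hM₀, hcM₀, t₀, ht₀⟩ :=
    InfSentence.exists_model_of_sequence hL hlin hM₁ hs I hI.ge
  obtain ⟨M, _, _, hM, hcM, t, ht⟩ :=
    InfSentence.exists_model_of_sequence hL hlin hM₁ hs Set.univ (by rwa [mk_univ, hcard])
  rw [mk_univ, hcard] at hcM
  have : Countable M₀ := Cardinal.mk_le_aleph0_iff.1 (hcM₀.trans hI).le
  have hF₀ : (relField (binRel lt M₀)).Infinite := by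
    have : Infinite I := Cardinal.infinite_iff.2 hI.ge
    refine (Set.infinite_range_of_injective (f := t₀) fun i j hij => ?_).mono ?_
    · by_contra hne
      rcases lt_or_gt_of_ne hne with h | h
      · exact (hlin M₀ hM₀).irrefl _ (hij ▸ ht₀ _ _ h)
      · exact (hlin M₀ hM₀).irrefl _ (hij ▸ ht₀ _ _ h)
    · rintro _ ⟨i, rfl⟩
      obtain ⟨j, hj⟩ := exists_ne i
      exact ⟨t₀ j, (lt_or_gt_of_ne hj.symm).imp (ht₀ _ _) (ht₀ _ _)⟩
  obtain ⟨W₀, _, _, h₀, D₀, hW₀⟩ := (hlin M₀ hM₀).exists_countable_isTreeOver hF₀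
  obtain ⟨W, h, D, hW, hcW⟩ := (hlin M hM).exists_isTreeOver_two_power_le hlam hcM
    (s := fun i => t ⟨i, trivial⟩) fun i j hij => ht _ _ hij
  obtain ⟨σ, hσ, hσ'⟩ := InfSentence.exists_scott hL M₀
  -- Completeness of φ carries the Scott sentence of M₀ over to M.
  have hMσ : σ.Models M := by
    rcases hφ.2 σ with H | H
    · exact H M hM
    · exact (H M₀ hM₀ hσ).elim
  obtain ⟨S, hSne, hS⟩ := hσ' M hMσ
  let _ := treeStructure L h D
  let _ := treeStructure L h₀ D₀
  have hL' := countable_treeLanguage hL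
  obtain ⟨φ', hφ', hφ''⟩ := InfSentence.exists_scott hL' W₀
  have hWφ : φ'.Models W := by
    obtain ⟨T, hTne, hT⟩ := hW.exists_isBackForth hS hSne (hlin M hM) (hlin M₀ hM₀) hW₀
    exact (hT.models_iff hTne φ').2 hφ'
  have hinf : ℵ₀ ≤ (2 : Cardinal.{w}) ^ lam := hlam.trans (Cardinal.cantor lam).le
  refine ⟨hinf, treeLanguage L, φ', hL', ⟨⟨W₀, inferInstance, inferInstance, hφ'⟩, fun ψ => ?_⟩,
    fun μ hμ hμ' => ?_, ?_⟩
  · have key : ∀ (B : Type w) [(treeLanguage L).Structure B], φ'.Models B →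
        (ψ.Models B ↔ ψ.Models W₀) := by
      intro B _ hB
      obtain ⟨T, hTne, hT⟩ := hφ'' B hB
      exact hT.models_iff hTne ψ
    by_cases hψ : ψ.Models W₀
    · exact .inl fun B _ _ hB => (key B hB).2 hψ
    · exact .inr fun B _ _ hB h => hψ ((key B hB).1 h)
  · obtain ⟨X, hX⟩ := Cardinal.le_mk_iff_exists_set.1 (hμ'.trans hcW)
    obtain ⟨N, hXN, hc, hN⟩ := InfSentence.exists_substructure hL' φ' hWφ X (hX ▸ hμ)
    have : Infinite N := Cardinal.infinite_iff.2 (by rwa [hc, hX])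
    exact ⟨N, inferInstance, inferInstance, hN, hc.trans hX⟩
  · rintro ⟨B, _, _, hB, hcB⟩
    obtain ⟨T, hTne, hT⟩ := hφ'' B hB
    -- B is a tree over a base equivalent to M₀, which therefore satisfies φ and has a field of size
    -- at most λ.
    obtain ⟨M', _, h', D', hB', T', hTne', hT'⟩ := hW₀.exists_of_isBackForth B hTne hT
    have hM' : φ.Models M' := (hT'.models_iff hTne' φ).2 hM₀
    have : Nonempty M' := Nonempty.map h' inferInstance
    have := hB'.mk_le (hlin M' hM') hlam
      (InfSentence.mk_relField_le hL hlam hlin hbound hM')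
    exact (Order.lt_succ _).not_ge (hcB ▸ this)
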